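/- Let $\mathfrak{su}(3)$ be the real Lie algebra of traceless skew-Hermitian complex $3\times 3$ matrices. For a real number $D>0$ let $N_D$ be the number of equivalence classes of finite-dimensional irreducible complex representations of $\mathfrak{su}(3)$ (complex vector spaces $V\neq 0$ with a homomorphism of real Lie algebras $\mathfrak{su}(3)\to\operatorname{End}_{\mathbb C}(V)$ and no invariant complex subspaces other than $0$ and $V$) with $\dim_{\mathbb C}V<D$. Put $$k_D=\lfloor 2D^{1/3}\rfloor,\qquad l_D=\Big\lfloor \tfrac12\big(1+\sqrt{1+8D}\big)\Big\rfloor,$$ $$y_\pm=y_\pm(x)=\frac{x-2}{2}\pm\frac12\Big(x^2-\frac{8D}{x}\Big)^{1/2},$$ $$F(D)=\frac12\,l_D(l_D-1)-\sum_{x=k_D+1}^{l_D}\big(\lfloor y_+\rfloor-\lceil y_-\rceil+1\big),$$ where $\lfloor\cdot\rfloor$ and $\lceil\cdot\rceil$ are the usual floor and ceiling and the sum runs over integers $x$. Then $N_D$ is finite. If $D$ is not the cube of an integer, then $N_D=F(D)$ exactly. If $D$ is the cube of an integer, then $N_D=F(D)-1$. -/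

import Mathlib

attribute [local instance 100] LieRing.ofAssociativeRing

noncomputable section

/-- The real Lie algebra `su(n)` of traceless skew-Hermitian complex `n × n` matrices, with the
commutator as bracket. -/
def su (n : ℕ) : LieSubalgebra ℝ (Matrix (Fin n) (Fin n) ℂ) where
  carrier := {A | A.conjTranspose = -A ∧ A.trace = 0}
  zero_mem' := by simp
  add_mem' := by
    rintro A B ⟨hA, hA'⟩ ⟨hB, hB'⟩
    refine ⟨?_, ?_⟩
    · rw [Matrix.conjTranspose_add, hA, hB, neg_add]
    · rw [Matrix.trace_add, hA', hB', add_zero]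
  smul_mem' := by
    rintro c A ⟨hA, hA'⟩
    refine ⟨?_, ?_⟩
    · rw [Matrix.conjTranspose_smul, hA, star_trivial, smul_neg]
    · rw [Matrix.trace_smul, hA', smul_zero]
  lie_mem' := by
    rintro A B ⟨hA, _⟩ ⟨hB, _⟩
    refine ⟨?_, ?_⟩
    · rw [Ring.lie_def, Matrix.conjTranspose_sub, Matrix.conjTranspose_mul,
        Matrix.conjTranspose_mul, hA, hB]
      simp
    · rw [Ring.lie_def, Matrix.trace_sub, Matrix.trace_mul_comm, sub_self]

/-- A finite-dimensional irreducible complex representation of a real Lie algebra `L`. The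
representation space is taken to be `ℂ ^ dim`: choosing a basis, every finite-dimensional complex
representation is equivalent to one of this form. Irreducibility means that the space is nonzero
and that it has no invariant complex subspaces besides `0` and the whole space. -/
structure LieIrrep (L : Type*) [LieRing L] [LieAlgebra ℝ L] where
  dim : ℕ
  ρ : L →ₗ⁅ℝ⁆ Module.End ℂ (Fin dim → ℂ)
  dim_pos : 0 < dim
  irreducible : ∀ W : Submodule ℂ (Fin dim → ℂ),
    (∀ a : L, ∀ w ∈ W, ρ a w ∈ W) → W = ⊥ ∨ W = ⊤

namespace LieIrrep

/-- Equivalence (isomorphism) of representations: there is a complex-linear bijection that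
intertwines the two actions. -/
def Equivalent {L : Type*} [LieRing L] [LieAlgebra ℝ L] (V W : LieIrrep L) : Prop :=
  ∃ e : (Fin V.dim → ℂ) ≃ₗ[ℂ] (Fin W.dim → ℂ), ∀ (a : L) (v : Fin V.dim → ℂ),
    e (V.ρ a v) = W.ρ a (e v)

theorem Equivalent.dim_eq {L : Type*} [LieRing L] [LieAlgebra ℝ L] {V W : LieIrrep L}
    (h : V.Equivalent W) : V.dim = W.dim := by
  obtain ⟨e, -⟩ := h
  simpa using e.finrank_eq

instance setoid (L : Type*) [LieRing L] [LieAlgebra ℝ L] : Setoid (LieIrrep L) where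
  r := Equivalent
  iseqv :=
    { refl := fun V => ⟨LinearEquiv.refl ℂ _, fun _ _ => rfl⟩
      symm := by
        rintro V W ⟨e, he⟩
        refine ⟨e.symm, fun a w => ?_⟩
        rw [LinearEquiv.symm_apply_eq, he, LinearEquiv.apply_symm_apply]
      trans := by
        rintro U V W ⟨e, he⟩ ⟨f, hf⟩
        refine ⟨e.trans f, fun a v => ?_⟩
        rw [LinearEquiv.trans_apply, LinearEquiv.trans_apply, he, hf] }

end LieIrrep

/-- The equivalence classes of finite-dimensional irreducible complex representations of `L`. -/
def IrrepClass (L : Type*) [LieRing L] [LieAlgebra ℝ L] : Type _ :=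
  Quotient (LieIrrep.setoid L)

/-- The (complex) dimension of an equivalence class of irreducible representations. -/
def IrrepClass.dim {L : Type*} [LieRing L] [LieAlgebra ℝ L] : IrrepClass L → ℕ :=
  Quotient.lift LieIrrep.dim fun _ _ h => LieIrrep.Equivalent.dim_eq h

/-- The set of equivalence classes of irreducible representations of `su(3)` whose dimension is
less than `D`. -/
def su3IrrepsBelow (D : ℝ) : Set (IrrepClass (su 3)) :=
  {c | (c.dim : ℝ) < D}

/-- `N_D`, the number of irreducible representations of `su(3)` of dimension less than `D`. -/
def irrepCount (D : ℝ) : ℕ :=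
  (su3IrrepsBelow D).ncard

/-- `k_D = ⌊2 D^(1/3)⌋`. -/
def kIndex (D : ℝ) : ℤ :=
  ⌊2 * D ^ (1 / 3 : ℝ)⌋

/-- `l_D = ⌊(1 + √(1 + 8 D)) / 2⌋`. -/
def lIndex (D : ℝ) : ℤ :=
  ⌊(1 / 2 : ℝ) * (1 + √(1 + 8 * D))⌋

/-- `y_+ = (x - 2) / 2 + (x² - 8 D / x)^(1/2) / 2`. -/
def yPlus (D x : ℝ) : ℝ :=
  (x - 2) / 2 + (1 / 2) * √(x ^ 2 - 8 * D / x)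

/-- `y_- = (x - 2) / 2 - (x² - 8 D / x)^(1/2) / 2`. -/
def yMinus (D x : ℝ) : ℝ :=
  (x - 2) / 2 - (1 / 2) * √(x ^ 2 - 8 * D / x)

/-- The closed expression
`l_D (l_D - 1) / 2 - ∑_{x = k_D + 1}^{l_D} (⌊y_+⌋ - ⌈y_-⌉ + 1)`. -/
def countFormula (D : ℝ) : ℝ :=
  (1 / 2 : ℝ) * (lIndex D : ℝ) * ((lIndex D : ℝ) - 1)
    - ∑ x ∈ Finset.Icc (kIndex D + 1) (lIndex D),
        ((⌊yPlus D (x : ℝ)⌋ : ℝ) - (⌈yMinus D (x : ℝ)⌉ : ℝ) + 1)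

end

/-! The finite-dimensional irreducible representations are classified by pairs of Dynkin labels `(p,
q)` of natural numbers, and the one with labels `(p, q)` has dimension `(p + 1)(q + 1)(p + q + 2) /
2`. The rest is a lattice point count.

Classification. Since `sl(3) = su(3) + i su(3)`, a complex representation of `su(3)` is the same as
operators satisfying the relations of the matrix units of `gl(3)`, with the identity acting as zero
(`GL3Ops`). Each such finite-dimensional nonzero module has a highest weight vector, its labels are
natural numbers by `sl(2)` theory, and they determine an irreducible module
(`IsHighest.exists_equiv`). Existence comes from an explicit Gelfand-Tsetlin basis `e k l m` with `k
≤ p`, `l ≤ q`, `m ≤ k + l`, rescaled so that no square roots occur; counting the basis gives the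
dimension (`finrank_S`).

Counting. Put `x = p + q + 2` and `y = p`, so that twice the dimension is `(y + 1)(x - 1 - y) x`,
with `x - 1` choices of `y` for each `x`. The smallest value over `y` is `x (x - 1)`, so only `x ≤
l_D` matter, and these give `l_D (l_D - 1) / 2` pairs. The pairs of dimension at least `D` are to be
removed. The product equals `(x² - (2y + 2 - x)²) x / 4`, so for `x > k_D` they are the integers in
`[y_-, y_+]`. For `x ≤ k_D`, where `x³ ≤ 8 D`, one is left only in the equality case `x = 2(y + 1)`,
`D = (y + 1)³`. This single pair, which `F(D)` does not remove, is the correction `-1` for cubes. -/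

noncomputable section

/-! ### Gelfand-Tsetlin formulas for `gl(3)` -/

/-- The space with basis `e k l m`, `k l m : ℕ`. -/
def GTSpace : Type := ℕ × ℕ × ℕ →₀ ℂ

namespace GTSpace

instance : AddCommGroup GTSpace := inferInstanceAs (AddCommGroup (ℕ × ℕ × ℕ →₀ ℂ))

instance : Module ℂ GTSpace := inferInstanceAs (Module ℂ (ℕ × ℕ × ℕ →₀ ℂ))

/-- The basis indexed by triples of natural numbers. -/
def basis : Module.Basis (ℕ × ℕ × ℕ) ℂ GTSpace := .ofRepr (LinearEquiv.refl ℂ (ℕ × ℕ × ℕ →₀ ℂ))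

/-- The basis vector with index `(k, l, m)`. -/
def e (k l m : ℕ) : GTSpace := basis (k, l, m)

/-- The linear map with prescribed values on the basis `e`. -/
def lift (f : ℕ → ℕ → ℕ → GTSpace) : Module.End ℂ GTSpace :=
  basis.constr ℂ fun x => f x.1 x.2.1 x.2.2

@[simp] theorem lift_e (f : ℕ → ℕ → ℕ → GTSpace) (k l m : ℕ) : lift f (e k l m) = f k l m := by
  simp [lift, e, Module.Basis.constr_basis]

/-- The coordinates with respect to the basis `e`. -/
def coord (k l m : ℕ) : GTSpace →ₗ[ℂ] ℂ := basis.coord (k, l, m)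

theorem coord_e (k l m k' l' m' : ℕ) :
    coord k' l' m' (e k l m) = if k = k' ∧ l = l' ∧ m = m' then 1 else 0 := by
  simp [coord, e, Finsupp.single_apply]

/-- A coefficient of the operators that raise the `gl(2)` spin. -/
def up (a b k l : ℕ) : ℂ := ((a : ℂ) - k) * (b + k + 2) / ((k + l + 1) * (k + l + 2))

/-- The matrix units of `gl(3)` in the Gelfand--Tsetlin model of highest weight `(p, q)`. -/
def E (p q : ℕ) : Fin 3 → Fin 3 → Module.End ℂ GTSpace :=
  ![![lift fun k l m => ((m : ℂ) - l + (q - p) / 3) • e k l m,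
      lift fun k l m => ((k : ℂ) + l - m) • e k l (m + 1),
      lift fun k l m => up p q k l • e (k + 1) l (m + 1)
        + ((l : ℂ) * (k + l - m)) • e k (l - 1) m],
    ![lift fun k l m => (m : ℂ) • e k l (m - 1),
      lift fun k l m => ((k : ℂ) - m + (q - p) / 3) • e k l m,
      lift fun k l m => up p q k l • e (k + 1) l m
        - ((l : ℂ) * m) • e k (l - 1) (m - 1)],
    ![lift fun k l m => ((k : ℂ) * m) • e (k - 1) l (m - 1)
        + up q p l k • e k (l + 1) m,
      lift fun k l m => ((k : ℂ) * (k + l - m)) • e (k - 1) l m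
        - up q p l k • e k (l + 1) (m + 1),
      lift fun k l m => ((l : ℂ) - k - 2 * ((q - p) / 3)) • e k l m]]


-- Antisymmetry allows the pairs to be ordered, and the three excluded commutators follow later from
-- the Jacobi identity. The bound on `m` is essential: the denominators degenerate at `k = l = 0`,
-- where for `m > 0` the relation for `[E02, E20]` fails.
set_option maxHeartbeats 4000000 in
theorem E_comm_lt (p q : ℕ) (i j r s : Fin 3) (hlt : 3 * (i : ℕ) + j < 3 * r + s)
    (hne : (i, j, r, s) ≠ (0, 2, 2, 1) ∧ (i, j, r, s) ≠ (1, 2, 2, 0) ∧ (i, j, r, s) ≠ (1, 2, 2, 1))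
    (k l m : ℕ) (h : m ≤ k + l) :
    (E p q i j * E p q r s - E p q r s * E p q i j) (e k l m) =
    ((if j = r then E p q i s else 0) - (if s = i then E p q r j else 0)) (e k l m) := by
  fin_cases i <;> fin_cases j <;> fin_cases r <;> fin_cases s <;>
  first
  | (exfalso; revert hlt; decide)
  | (exfalso; revert hne; decide)
  | (clear hlt; simp [E]; done)
  | (clear hlt; simp [E]; module)
  | (clear hlt; simp [E]
     rcases k with _ | k <;> rcases l with _ | l <;> rcases m with _ | m <;> simp [up] at h ⊢ <;>
     match_scalars <;>
     field_simp (disch := first | (norm_cast; done) | (norm_cast; omega) | norm_num) <;> ring)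

end GTSpace

/-! ### Modules over `gl(3)` and complexification of `su(3)` -/

/-- Operators on `V` satisfying the relations of the matrix units of `gl(3)`, with the identity
matrix acting as zero. -/
structure GL3Ops (V : Type*) [AddCommGroup V] [Module ℂ V] where
  R : Fin 3 → Fin 3 → Module.End ℂ V
  comm : ∀ i j r s, R i j * R r s - R r s * R i j =
    (if j = r then R i s else 0) - (if s = i then R r j else 0)
  sum_diag : ∑ i, R i i = 0

namespace GL3Ops

open Matrix

variable {V : Type*} [AddCommGroup V] [Module ℂ V] (G : GL3Ops V)

/-- The action of a matrix. -/
def op : Matrix (Fin 3) (Fin 3) ℂ →ₗ[ℂ] Module.End ℂ V where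
  toFun A := ∑ i, ∑ j, A i j • G.R i j
  map_add' A B := by simp [add_smul, Finset.sum_add_distrib]
  map_smul' c A := by simp [Finset.smul_sum, mul_smul]

theorem op_apply (A : Matrix (Fin 3) (Fin 3) ℂ) : G.op A = ∑ i, ∑ j, A i j • G.R i j := rfl

@[simp] theorem op_single (i j : Fin 3) (c : ℂ) : G.op (single i j c) = c • G.R i j := by
  simp [op_apply, single_apply, ite_and, Finset.sum_ite_eq]

@[simp] theorem op_one : G.op 1 = 0 := by
  simp [op_apply, one_apply, Finset.sum_ite_eq, G.sum_diag]

theorem op_lie (A B : Matrix (Fin 3) (Fin 3) ℂ) : G.op ⁅A, B⁆ = ⁅G.op A, G.op B⁆ := by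
  simp only [Ring.lie_def]
  induction A using Matrix.induction_on' with
  | h_zero => simp
  | h_add A A' h h' =>
    rw [add_mul, mul_add, add_sub_add_comm, map_add, h, h', map_add]
    noncomm_ring
  | h_std_basis i j c =>
    induction B using Matrix.induction_on' with
    | h_zero => simp
    | h_add B B' h h' =>
      rw [add_mul, mul_add, add_sub_add_comm, map_add, h, h', map_add]
      noncomm_ring
    | h_std_basis r s d =>
      rw [op_single, op_single, smul_mul_smul_comm, smul_mul_smul_comm, mul_comm d c, ← smul_sub,
        G.comm, map_sub, smul_sub]
      congr 1
      · split_ifs with h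
        · subst h; simp
        · simp [single_mul_single_of_ne _ _ _ _ h]
      · split_ifs with h
        · subst h; simp [mul_comm]
        · simp [single_mul_single_of_ne _ _ _ _ h]

/-- The restriction of the action to `su 3`. -/
def lieHom : su 3 →ₗ⁅ℝ⁆ Module.End ℂ V where
  toFun A := G.op A
  map_add' A B := by simp
  map_smul' c A := by
    ext v
    simp [op_apply, LinearMap.sum_apply, Finset.smul_sum]
  map_lie' {A B} := by simpa using G.op_lie A B

@[simp] theorem lieHom_apply (A : su 3) : G.lieHom A = G.op A := rfl

end GL3Ops

namespace su

open Matrix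

/-- The skew-Hermitian traceless part of a matrix. -/
def proj : Matrix (Fin 3) (Fin 3) ℂ →ₗ[ℝ] su 3 where
  toFun Z := ⟨(1 / 2 : ℝ) • ((Z - Zᴴ) - ((1 / 3 : ℂ) * (Z - Zᴴ).trace) • 1), by
    refine ⟨?_, ?_⟩
    · simp only [conjTranspose_smul, conjTranspose_sub, conjTranspose_conjTranspose, star_trivial,
        conjTranspose_one, trace_sub, trace_conjTranspose, star_mul', star_sub, star_star]
      rw [← smul_neg]
      congr 1
      have : star (1 / 3 : ℂ) = 1 / 3 := by simp
      rw [this]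
      module
    · simp; ring⟩
  map_add' Z W := by
    ext1
    simp only [conjTranspose_add, trace_sub, trace_add, AddMemClass.coe_add]
    module
  map_smul' c Z := by
    ext1
    have : star (c : ℂ) = c := by simp
    simp only [conjTranspose_smul, trace_sub, trace_smul, SetLike.val_smul,
      RingHom.id_apply, ← Complex.coe_smul, this]
    module

theorem coe_proj (Z : Matrix (Fin 3) (Fin 3) ℂ) : (proj Z : Matrix (Fin 3) (Fin 3) ℂ) =
    (1 / 2 : ℝ) • ((Z - Zᴴ) - ((1 / 3 : ℂ) * (Z - Zᴴ).trace) • 1) := rfl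

/-- `i Y` is Hermitian and traceless, so it does not contribute to the skew-Hermitian part. -/
theorem proj_add_I_smul (X Y : su 3) :
    proj ((X : Matrix (Fin 3) (Fin 3) ℂ) + Complex.I • (Y : Matrix (Fin 3) (Fin 3) ℂ)) = X := by
  ext1
  obtain ⟨X, hX, hX'⟩ := X
  obtain ⟨Y, hY, hY'⟩ := Y
  have : star Complex.I = -Complex.I := by simp
  simp only [coe_proj, conjTranspose_add, conjTranspose_smul, hX, hY, trace_sub, trace_add,
    trace_smul, trace_neg, hX', hY', this]
  rw [← Complex.coe_smul]
  push_cast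
  module

theorem proj_I_smul_add_I_smul (X Y : su 3) :
    proj (-Complex.I • ((X : Matrix (Fin 3) (Fin 3) ℂ) +
      Complex.I • (Y : Matrix (Fin 3) (Fin 3) ℂ))) = Y := by
  convert proj_add_I_smul Y (-X) using 2
  rw [smul_add, smul_smul]
  simp [add_comm]

theorem proj_add_I_smul_proj (Z : Matrix (Fin 3) (Fin 3) ℂ) :
    (proj Z : Matrix (Fin 3) (Fin 3) ℂ) + Complex.I • (proj (-Complex.I • Z) : Matrix _ _ ℂ) =
      Z - ((1 / 3 : ℂ) * Z.trace) • 1 := by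
  have : star (-Complex.I) = Complex.I := by simp
  simp only [coe_proj, conjTranspose_smul, trace_sub, trace_smul, this]
  simp only [← Complex.coe_smul]
  push_cast
  match_scalars <;> ring_nf <;> simp <;> ring

end su

namespace GL3Ops

open Matrix

variable {V : Type*} [AddCommGroup V] [Module ℂ V]

/-- The complex-linear extension to `gl(3)` of a representation of `su 3`. -/
def extend (ρ : su 3 →ₗ⁅ℝ⁆ Module.End ℂ V) : Matrix (Fin 3) (Fin 3) ℂ →ₗ[ℂ] Module.End ℂ V where
  toFun Z := ρ (su.proj Z) + Complex.I • ρ (su.proj (-Complex.I • Z))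
  map_add' Z W := by simp only [smul_add, map_add]; abel
  map_smul' c Z := by
    have h1 (a : ℝ) (X : su 3) : ρ (a • X) = (a : ℂ) • ρ X := by
      rw [map_smul]; rfl
    have h : c • Z = c.re • Z + c.im • (Complex.I • Z) := by
      simp only [← Complex.coe_smul]
      rw [smul_smul, ← add_smul, Complex.re_add_im]
    have h2 : -Complex.I • c • Z = c.re • (-Complex.I • Z) + c.im • Z := by
      rw [h]
      simp only [← Complex.coe_smul, smul_add]
      match_scalars
      ring_nf
      simp
    have h3 : su.proj (Complex.I • Z) = - su.proj (-Complex.I • Z) := by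
      rw [← map_neg, neg_smul, neg_neg]
    rw [h2, h]
    simp only [map_add, map_smul, h1, h3, map_neg, RingHom.id_apply]
    nth_rw 5 [← Complex.re_add_im c]
    match_scalars <;> ring_nf <;> simp

theorem extend_apply (ρ : su 3 →ₗ⁅ℝ⁆ Module.End ℂ V) (Z : Matrix (Fin 3) (Fin 3) ℂ) :
    extend ρ Z = ρ (su.proj Z) + Complex.I • ρ (su.proj (-Complex.I • Z)) := rfl

theorem extend_coe (ρ : su 3 →ₗ⁅ℝ⁆ Module.End ℂ V) (A : su 3) : extend ρ A = ρ A := by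
  have h1 := su.proj_add_I_smul A 0
  have h2 := su.proj_I_smul_add_I_smul A 0
  simp only [ZeroMemClass.coe_zero, smul_zero, add_zero] at h1 h2
  rw [extend_apply, h1, h2, map_zero, smul_zero, add_zero]

theorem extend_one (ρ : su 3 →ₗ⁅ℝ⁆ Module.End ℂ V) : extend ρ 1 = 0 := by
  have h1 : su.proj 1 = 0 := by ext1; simp [su.coe_proj]
  have h2 : su.proj (-Complex.I • 1) = 0 := by
    ext1
    simp [su.coe_proj, ← Complex.coe_smul, conjTranspose_smul, trace_smul]
    module
  rw [extend_apply, h1, h2, map_zero, smul_zero, add_zero]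

theorem lie_decomp (X Y X' Y' : Matrix (Fin 3) (Fin 3) ℂ) :
    ⁅X + Complex.I • Y, X' + Complex.I • Y'⁆ =
      (⁅X, X'⁆ - ⁅Y, Y'⁆) + Complex.I • (⁅X, Y'⁆ + ⁅Y, X'⁆) := by
  simp only [Ring.lie_def, mul_add, add_mul, smul_mul_assoc, mul_smul_comm, smul_add, smul_sub,
    smul_smul, Complex.I_mul_I]
  module

/-- Scalar matrices are central, so the bracket only sees the traceless parts; these are written as
`X + i Y` with `X`, `Y` in `su(3)` and the bracket is expanded bilinearly. -/
theorem extend_lie (ρ : su 3 →ₗ⁅ℝ⁆ Module.End ℂ V) (Z W : Matrix (Fin 3) (Fin 3) ℂ) :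
    extend ρ ⁅Z, W⁆ = ⁅extend ρ Z, extend ρ W⁆ := by
  have hsc (Z W : Matrix (Fin 3) (Fin 3) ℂ) (c d : ℂ) : ⁅Z - c • 1, W - d • 1⁆ = ⁅Z, W⁆ := by
    simp only [Ring.lie_def, mul_sub, sub_mul, smul_mul_assoc, mul_smul_comm, smul_sub, one_mul,
      mul_one, smul_smul]
    rw [mul_comm c d]
    abel
  set X := su.proj Z
  set Y := su.proj (-Complex.I • Z)
  set X' := su.proj W
  set Y' := su.proj (-Complex.I • W)
  have key : ⁅Z, W⁆ = ((⁅X, X'⁆ - ⁅Y, Y'⁆ : su 3) : Matrix (Fin 3) (Fin 3) ℂ) +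
      Complex.I • ((⁅X, Y'⁆ + ⁅Y, X'⁆ : su 3) : Matrix (Fin 3) (Fin 3) ℂ) := by
    rw [← hsc Z W _ _, ← su.proj_add_I_smul_proj, ← su.proj_add_I_smul_proj, lie_decomp]
    simp [X, Y, X', Y']
  rw [extend_apply, extend_apply ρ Z, extend_apply ρ W, key, su.proj_add_I_smul,
    su.proj_I_smul_add_I_smul]
  change _ = ⁅ρ X + Complex.I • ρ Y, ρ X' + Complex.I • ρ Y'⁆
  simp only [map_add, map_sub, LieHom.map_lie]
  simp only [Ring.lie_def, mul_add, add_mul, smul_mul_assoc, mul_smul_comm, smul_add, smul_sub,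
    smul_smul, Complex.I_mul_I]
  module

/-- The operators by which the complexification of `ρ` acts. -/
def ofLieHom (ρ : su 3 →ₗ⁅ℝ⁆ Module.End ℂ V) : GL3Ops V where
  R i j := extend ρ (single i j 1)
  comm i j r s := by
    rw [← Ring.lie_def, ← extend_lie, Ring.lie_def, map_sub]
    congr 1
    · split_ifs with h
      · subst h; simp
      · simp [single_mul_single_of_ne _ _ _ _ h]
    · split_ifs with h
      · subst h; simp
      · simp [single_mul_single_of_ne _ _ _ _ h]
  sum_diag := by
    rw [← map_sum, ← extend_one ρ]
    congr 1
    ext i j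
    simp [Matrix.sum_apply, single_apply, one_apply, ite_and]

theorem lieHom_ofLieHom (ρ : su 3 →ₗ⁅ℝ⁆ Module.End ℂ V) : (ofLieHom ρ).lieHom = ρ := by
  ext1 A
  have h : (ofLieHom ρ).op = extend ρ := by
    refine LinearMap.ext fun Z => ?_
    induction Z using Matrix.induction_on' with
    | h_zero => simp
    | h_add A A' h h' => rw [map_add, h, h', map_add]
    | h_std_basis i j c =>
      rw [op_single]
      change c • extend ρ (single i j 1) = _
      rw [← map_smul, smul_single, smul_eq_mul, mul_one]
  rw [lieHom_apply, h, extend_coe]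

variable (G : GL3Ops V)

theorem R_eq_lieHom (i j : Fin 3) : G.R i j = G.lieHom (su.proj (single i j 1)) +
    Complex.I • G.lieHom (su.proj (-Complex.I • single i j 1)) := by
  have h := congrArg G.op (su.proj_add_I_smul_proj (single i j 1))
  rw [map_add, map_smul G.op, map_sub, map_smul G.op, op_one, op_single, one_smul, smul_zero,
    sub_zero] at h
  exact h.symm

/-- A subspace is invariant under `su 3` iff it is invariant under the matrix units. -/
theorem invariant_iff (W : Submodule ℂ V) :
    (∀ A : su 3, ∀ w ∈ W, G.lieHom A w ∈ W) ↔ ∀ i j, ∀ w ∈ W, G.R i j w ∈ W := by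
  constructor
  · intro h i j w hw
    rw [R_eq_lieHom]
    exact W.add_mem (h _ w hw) (W.smul_mem _ (h _ w hw))
  · intro h A w hw
    simp only [lieHom_apply, op_apply, LinearMap.sum_apply, LinearMap.smul_apply]
    exact W.sum_mem fun i _ => W.sum_mem fun j _ => W.smul_mem _ (h i j w hw)

theorem intertwines_iff {V' : Type*} [AddCommGroup V'] [Module ℂ V'] (G' : GL3Ops V')
    (f : V →ₗ[ℂ] V') : (∀ (A : su 3) v, f (G.lieHom A v) = G'.lieHom A (f v)) ↔
      ∀ i j v, f (G.R i j v) = G'.R i j (f v) := by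
  constructor
  · intro h i j v
    rw [R_eq_lieHom, R_eq_lieHom]
    simp only [LinearMap.add_apply, LinearMap.smul_apply, map_add, map_smul, h]
  · intro h A v
    simp only [lieHom_apply, op_apply, LinearMap.sum_apply, LinearMap.smul_apply, map_sum, map_smul,
      h]

end GL3Ops

/-! ### Highest weight theory -/

namespace GL3Ops

variable {V : Type*} [AddCommGroup V] [Module ℂ V] (G : GL3Ops V)

theorem comm_apply (i j r s : Fin 3) (v : V) : G.R i j (G.R r s v) = G.R r s (G.R i j v) +
    ((if j = r then G.R i s v else 0) - (if s = i then G.R r j v else 0)) := by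
  have h := congrArg (fun f : Module.End ℂ V => f v) (G.comm i j r s)
  simp only [LinearMap.sub_apply, Module.End.mul_apply] at h
  rw [← sub_eq_iff_eq_add', h]
  split_ifs <;> simp

theorem diag_sum_apply (v : V) : G.R 0 0 v + G.R 1 1 v + G.R 2 2 v = 0 := by
  have h := congrArg (fun f : Module.End ℂ V => f v) G.sum_diag
  simpa [Fin.sum_univ_three] using h

/-- A subspace stable under the four simple root vectors is stable under all matrix units. -/
theorem invariant_of_simple {W : Submodule ℂ V} (h01 : ∀ w ∈ W, G.R 0 1 w ∈ W)
    (h12 : ∀ w ∈ W, G.R 1 2 w ∈ W) (h10 : ∀ w ∈ W, G.R 1 0 w ∈ W)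
    (h21 : ∀ w ∈ W, G.R 2 1 w ∈ W) (i j : Fin 3) (w : V) (hw : w ∈ W) : G.R i j w ∈ W := by
  have c1 : G.R 0 0 w - G.R 1 1 w ∈ W := by
    have := G.comm_apply 0 1 1 0 w
    simp only [if_true] at this
    rw [← sub_eq_iff_eq_add'] at this
    exact this ▸ W.sub_mem (h01 _ (h10 _ hw)) (h10 _ (h01 _ hw))
  have c2 : G.R 1 1 w - G.R 2 2 w ∈ W := by
    have := G.comm_apply 1 2 2 1 w
    simp only [if_true] at this
    rw [← sub_eq_iff_eq_add'] at this
    exact this ▸ W.sub_mem (h12 _ (h21 _ hw)) (h21 _ (h12 _ hw))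
  have hs := G.diag_sum_apply w
  have d0 : G.R 0 0 w ∈ W := by
    -- As the diagonal units sum to zero, `3 E00 = 2 (E00 - E11) + (E11 - E22)`.
    have : G.R 0 0 w = (1 / 3 : ℂ) • ((2 : ℂ) • (G.R 0 0 w - G.R 1 1 w) +
        (G.R 1 1 w - G.R 2 2 w)) := by
      rw [eq_neg_of_add_eq_zero_right hs]; module
    rw [this]
    exact W.smul_mem _ (W.add_mem (W.smul_mem _ c1) c2)
  have d1 : G.R 1 1 w ∈ W := by simpa using W.sub_mem d0 c1
  have d2 : G.R 2 2 w ∈ W := by simpa using W.sub_mem d1 c2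
  have e02 : G.R 0 2 w ∈ W := by
    have := G.comm_apply 0 1 1 2 w
    simp only [if_true, show ((2 : Fin 3) = 0) = False by decide, if_false, sub_zero] at this
    rw [← sub_eq_iff_eq_add'] at this
    exact this ▸ W.sub_mem (h01 _ (h12 _ hw)) (h12 _ (h01 _ hw))
  have e20 : G.R 2 0 w ∈ W := by
    have := G.comm_apply 2 1 1 0 w
    simp only [if_true, show ((0 : Fin 3) = 2) = False by decide, if_false, sub_zero] at this
    rw [← sub_eq_iff_eq_add'] at this
    exact this ▸ W.sub_mem (h21 _ (h10 _ hw)) (h10 _ (h21 _ hw))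
  fin_cases i <;> fin_cases j
  exacts [d0, h01 w hw, e02, h10 w hw, d1, h12 w hw, e20, h21 w hw, d2]

/-- The restriction to an invariant subspace. -/
def restrict (W : Submodule ℂ V) (hW : ∀ i j, ∀ w ∈ W, G.R i j w ∈ W) : GL3Ops W where
  R i j := (G.R i j).restrict (hW i j)
  comm i j r s := by
    ext w
    simp only [LinearMap.sub_apply, Module.End.mul_apply, Submodule.coe_sub,
      LinearMap.coe_restrict_apply, G.comm_apply i j r s, add_sub_cancel_left]
    split_ifs <;> simp
  sum_diag := by
    ext w
    simpa [Fin.sum_univ_three] using G.diag_sum_apply w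

@[simp] theorem coe_restrict_apply (W : Submodule ℂ V) (hW : ∀ i j, ∀ w ∈ W, G.R i j w ∈ W)
    (i j : Fin 3) (w : W) : ((G.restrict W hW).R i j w : V) = G.R i j w := rfl

/-- The direct sum. -/
def prod {V' : Type*} [AddCommGroup V'] [Module ℂ V'] (G' : GL3Ops V') : GL3Ops (V × V') where
  R i j := (G.R i j).prodMap (G'.R i j)
  comm i j r s := by
    refine LinearMap.ext fun x => Prod.ext ?_ ?_
    · simp only [LinearMap.sub_apply, Module.End.mul_apply, Prod.fst_sub, LinearMap.prodMap_apply,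
        G.comm_apply i j r s, add_sub_cancel_left]
      split_ifs <;> simp
    · simp only [LinearMap.sub_apply, Module.End.mul_apply, Prod.snd_sub, LinearMap.prodMap_apply,
        G'.comm_apply i j r s, add_sub_cancel_left]
      split_ifs <;> simp
  sum_diag := by
    refine LinearMap.ext fun x => Prod.ext ?_ ?_
    · simpa [Fin.sum_univ_three] using G.diag_sum_apply x.1
    · simpa [Fin.sum_univ_three] using G'.diag_sum_apply x.2

@[simp] theorem prod_R_apply {V' : Type*} [AddCommGroup V'] [Module ℂ V'] (G' : GL3Ops V')
    (i j : Fin 3) (x : V × V') : (G.prod G').R i j x = (G.R i j x.1, G'.R i j x.2) := rfl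

/-- `v` is a highest weight vector with Dynkin labels `a`, `b`. -/
structure IsHighest (v : V) (a b : ℂ) : Prop where
  ne_zero : v ≠ 0
  raise₁ : G.R 0 1 v = 0
  raise₂ : G.R 1 2 v = 0
  weight₁ : G.R 0 0 v - G.R 1 1 v = a • v
  weight₂ : G.R 1 1 v - G.R 2 2 v = b • v

/-- Both simple raising operators increase the eigenvalue of `E00 - E22` by one. The spectrum is
finite, so some eigenvalue `μ` has no successor `μ + 1`; its eigenspace is killed by both, and `E00
- E11` commutes with `E00 - E22` and so has an eigenvector there. -/
theorem exists_isHighest [FiniteDimensional ℂ V] [Nontrivial V] : ∃ v a b, G.IsHighest v a b := by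
  set H : Module.End ℂ V := G.R 0 0 - G.R 2 2 with hH
  obtain ⟨μ, hμ, hμ'⟩ : ∃ μ, H.HasEigenvalue μ ∧ ¬ H.HasEigenvalue (μ + 1) := by
    by_contra! hcon
    obtain ⟨μ, hμ⟩ := Module.End.exists_eigenvalue H
    have h (n : ℕ) : H.HasEigenvalue (μ + n) := by
      induction n with
      | zero => simpa using hμ
      | succ n ih => simpa [add_assoc] using hcon _ ih
    refine Set.infinite_of_injective_forall_mem (f := fun n : ℕ => μ + n) ?_ h
      H.finite_hasEigenvalue
    intro m n hmn
    simpa using hmn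
  have hbot : H.eigenspace (μ + 1) = ⊥ := by
    by_contra hne
    exact hμ' hne
  have raise (i j : Fin 3) (hij : ∀ x, H (G.R i j x) = G.R i j (H x) + G.R i j x) (x : V)
      (hx : x ∈ H.eigenspace μ) : G.R i j x = 0 := by
    rw [← Submodule.mem_bot ℂ, ← hbot, Module.End.mem_eigenspace_iff, hij,
      Module.End.mem_eigenspace_iff.1 hx, map_smul]
    module
  have r1 := raise 0 1 fun x => by
    simp [hH, G.comm_apply 0 0 0 1, G.comm_apply 2 2 0 1]; abel
  have r2 := raise 1 2 fun x => by
    simp [hH, G.comm_apply 0 0 1 2, G.comm_apply 2 2 1 2]; abel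
  set h : Module.End ℂ V := G.R 0 0 - G.R 1 1 with hh
  have hinv : ∀ x ∈ H.eigenspace μ, h x ∈ H.eigenspace μ := by
    intro x hx
    rw [Module.End.mem_eigenspace_iff] at hx ⊢
    rw [← map_smul, ← hx]
    simp [hH, hh, G.comm_apply 0 0 1 1, G.comm_apply 2 2 0 0, G.comm_apply 2 2 1 1]
    abel
  have : Nontrivial (H.eigenspace μ) := (Submodule.nontrivial_iff_ne_bot).2 hμ
  obtain ⟨a, ha⟩ := Module.End.exists_eigenvalue (h.restrict hinv)
  obtain ⟨⟨v, hv⟩, hva⟩ := ha.exists_hasEigenvector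
  have hw1 : h v = a • v := congrArg Subtype.val hva.apply_eq_smul
  have hv0 : v ≠ 0 := fun h0 => hva.2 (Subtype.ext h0)
  refine ⟨v, a, μ - a, hv0, r1 v hv, r2 v hv, by simpa [hh] using hw1, ?_⟩
  have hw2 : H v = μ • v := Module.End.mem_eigenspace_iff.1 hv
  rw [sub_smul, ← hw1, ← hw2]
  simp [hH, hh]

theorem exists_nat_weight {U : Type*} [AddCommGroup U] [Module ℂ U] [FiniteDimensional ℂ U]
    {h e f : Module.End ℂ U}
    (hef : e * f - f * e = h) (hhe : h * e - e * h = 2 • e) (hhf : h * f - f * h = -(2 • f))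
    {v : U} {μ : ℂ} (hv : v ≠ 0) (hev : e v = 0) (hhv : h v = μ • v) : ∃ n : ℕ, μ = n := by
  -- `IsSl2Triple` requires `h ≠ 0`; when `h = 0` the weight is zero.
  by_cases h0 : h = 0
  · refine ⟨0, ?_⟩
    rw [h0, LinearMap.zero_apply, eq_comm, smul_eq_zero] at hhv
    simpa [hv] using hhv
  · have t : IsSl2Triple h e f := ⟨h0, hef, hhe, hhf⟩
    have hp : t.HasPrimitiveVectorWith v μ := ⟨hv, hhv, hev⟩
    exact hp.exists_nat

theorem IsHighest.exists_nat [FiniteDimensional ℂ V] {v : V} {a b : ℂ} (h : G.IsHighest v a b) :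
    ∃ p q : ℕ, a = p ∧ b = q := by
  have hrel (i j : Fin 3) (hij : i ≠ j) : G.R i j * G.R j i - G.R j i * G.R i j =
      G.R i i - G.R j j ∧ (G.R i i - G.R j j) * G.R i j - G.R i j * (G.R i i - G.R j j) =
      2 • G.R i j ∧ (G.R i i - G.R j j) * G.R j i - G.R j i * (G.R i i - G.R j j) =
      -(2 • G.R j i) := by
    have h1 := G.comm i i i j
    have h2 := G.comm j j i j
    have h3 := G.comm i i j i
    have h4 := G.comm j j j i
    have h5 := G.comm i j j i
    simp only [if_true, hij, hij.symm, if_false] at h1 h2 h3 h4 h5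
    refine ⟨h5, ?_, ?_⟩
    · linear_combination (norm := noncomm_ring) h1 - h2
    · linear_combination (norm := noncomm_ring) h3 - h4
  obtain ⟨a1, a2, a3⟩ := hrel 0 1 (by decide)
  obtain ⟨b1, b2, b3⟩ := hrel 1 2 (by decide)
  obtain ⟨p, hp⟩ := exists_nat_weight a1 a2 a3 h.ne_zero h.raise₁ (by simpa using h.weight₁)
  obtain ⟨q, hq⟩ := exists_nat_weight b1 b2 b3 h.ne_zero h.raise₂ (by simpa using h.weight₂)
  exact ⟨p, q, hp, hq⟩

/-- A simple lowering operator. -/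
def lower : Bool → Module.End ℂ V
  | false => G.R 1 0
  | true => G.R 2 1

/-- The result of applying a word in the simple lowering operators to a vector. -/
def word (v : V) : List Bool → V
  | [] => v
  | b :: l => G.lower b (word v l)

/-- The span of all words in the simple lowering operators applied to `v`. -/
def wordSpan (v : V) : Submodule ℂ V := Submodule.span ℂ (Set.range (G.word v))

theorem word_mem (v : V) (l : List Bool) : G.word v l ∈ G.wordSpan v :=
  Submodule.subset_span ⟨l, rfl⟩

theorem wordSpan_induction {v : V} {f : Module.End ℂ V}
    (h : ∀ l, f (G.word v l) ∈ G.wordSpan v) (w : V) (hw : w ∈ G.wordSpan v) :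
    f w ∈ G.wordSpan v := by
  have : G.wordSpan v ≤ (G.wordSpan v).comap f := by
    rw [wordSpan, Submodule.span_le]
    rintro _ ⟨l, rfl⟩
    exact h l
  exact this hw

theorem lower_mem {v : V} (b : Bool) (w : V) (hw : w ∈ G.wordSpan v) :
    G.lower b w ∈ G.wordSpan v :=
  G.wordSpan_induction (fun l => G.word_mem v (b :: l)) w hw

variable {G}

/-- `c + d` is the eigenvalue of `E00 - E22`, which each simple lowering operator decreases by one;
it therefore records the length of the word. -/
theorem IsHighest.word_weight {v : V} {a b : ℂ} (h : G.IsHighest v a b) (l : List Bool) :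
    ∃ c d : ℂ, c + d = a + b - l.length ∧
      G.R 0 0 (G.word v l) - G.R 1 1 (G.word v l) = c • G.word v l ∧
      G.R 1 1 (G.word v l) - G.R 2 2 (G.word v l) = d • G.word v l := by
  induction l with
  | nil => exact ⟨a, b, by simp, h.weight₁, h.weight₂⟩
  | cons x l ih =>
    obtain ⟨c, d, hcd, hc, hd⟩ := ih
    cases x
    · refine ⟨c - 2, d + 1, by rw [List.length_cons]; push_cast; linear_combination hcd, ?_, ?_⟩
      · rw [word, lower, sub_smul, ← map_smul, ← hc]
        simp [G.comm_apply 0 0 1 0, G.comm_apply 1 1 1 0]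
        module
      · rw [word, lower, add_smul, ← map_smul, ← hd]
        simp [G.comm_apply 2 2 1 0, G.comm_apply 1 1 1 0]
        module
    · refine ⟨c + 1, d - 2, by rw [List.length_cons]; push_cast; linear_combination hcd, ?_, ?_⟩
      · rw [word, lower, add_smul, ← map_smul, ← hc]
        simp [G.comm_apply 0 0 2 1, G.comm_apply 1 1 2 1]
        module
      · rw [word, lower, sub_smul, ← map_smul, ← hd]
        simp [G.comm_apply 2 2 2 1, G.comm_apply 1 1 2 1]
        module

/-- A raising operator is moved past the outermost lowering operator. The commutator is zero or a
simple coroot, which acts on the shorter word by a scalar. -/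
theorem IsHighest.raise_word_mem {v : V} {a b : ℂ} (h : G.IsHighest v a b) (l : List Bool) :
    G.R 0 1 (G.word v l) ∈ G.wordSpan v ∧ G.R 1 2 (G.word v l) ∈ G.wordSpan v := by
  induction l with
  | nil => simp [word, h.raise₁, h.raise₂]
  | cons x l ih =>
    obtain ⟨c, d, -, hc, hd⟩ := h.word_weight l
    have hl (z : ℂ) := (G.wordSpan v).smul_mem z (G.word_mem v l)
    cases x
    · constructor
      · rw [word, lower, G.comm_apply 0 1 1 0]
        simp only [if_true, hc]
        exact add_mem (G.lower_mem false _ ih.1) (hl c)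
      · rw [word, lower, G.comm_apply 1 2 1 0]
        simpa [lower] using G.lower_mem false _ ih.2
    · constructor
      · rw [word, lower, G.comm_apply 0 1 2 1]
        simpa [lower] using G.lower_mem true _ ih.1
      · rw [word, lower, G.comm_apply 1 2 2 1]
        simp only [if_true, hd]
        exact add_mem (G.lower_mem true _ ih.2) (hl d)

theorem IsHighest.wordSpan_invariant {v : V} {a b : ℂ} (h : G.IsHighest v a b) (i j : Fin 3)
    (w : V) (hw : w ∈ G.wordSpan v) : G.R i j w ∈ G.wordSpan v :=
  G.invariant_of_simple (G.wordSpan_induction fun l => (h.raise_word_mem l).1)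
    (G.wordSpan_induction fun l => (h.raise_word_mem l).2) (G.lower_mem false) (G.lower_mem true)
    i j w hw

/-- The top weight space of the module generated by a highest weight vector is a line. -/
theorem IsHighest.mem_span_of_top {v : V} {a b : ℂ} (h : G.IsHighest v a b) {x : V}
    (hx : x ∈ G.wordSpan v) (hx' : G.R 0 0 x - G.R 2 2 x = (a + b) • x) :
    x ∈ Submodule.span ℂ {v} := by
  set H : Module.End ℂ V := G.R 0 0 - G.R 2 2 with hH
  have hword (l : List Bool) : G.word v l ∈ H.eigenspace (a + b - l.length) := by
    obtain ⟨c, d, hcd, hc, hd⟩ := h.word_weight l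
    rw [Module.End.mem_eigenspace_iff, ← hcd, add_smul, ← hc, ← hd]
    simp [hH]
  have hle : G.wordSpan v ≤
      Submodule.span ℂ {v} ⊔ ⨆ μ, ⨆ (_ : μ ≠ a + b), H.eigenspace μ := by
    rw [wordSpan, Submodule.span_le]
    rintro _ ⟨l, rfl⟩
    cases l with
    | nil => exact Submodule.mem_sup_left (Submodule.mem_span_singleton_self v)
    | cons y l =>
      refine Submodule.mem_sup_right ?_
      refine Submodule.mem_iSup_of_mem _ (Submodule.mem_iSup_of_mem ?_ (hword (y :: l)))
      rw [Ne, sub_eq_self, List.length_cons]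
      exact Nat.cast_ne_zero.2 (Nat.succ_ne_zero _)
  obtain ⟨y, hy, t, ht, rfl⟩ := Submodule.mem_sup.1 (hle hx)
  have hyH : y ∈ H.eigenspace (a + b) := by
    have := hword []
    simp only [word, List.length_nil, Nat.cast_zero, sub_zero] at this
    exact (Submodule.span_singleton_le_iff_mem _ _).2 this hy
  have hxH : y + t ∈ H.eigenspace (a + b) :=
    Module.End.mem_eigenspace_iff.2 (by simpa [hH] using hx')
  have htH : t ∈ H.eigenspace (a + b) := by simpa using sub_mem hxH hyH
  have := Submodule.disjoint_def.1 (H.eigenspaces_iSupIndep (a + b)) t htH ht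
  rwa [this, add_zero]

variable (G)

/-- There are no invariant subspaces besides `⊥` and `⊤`. -/
def Irreducible : Prop :=
  ∀ W : Submodule ℂ V, (∀ i j, ∀ w ∈ W, G.R i j w ∈ W) → W = ⊥ ∨ W = ⊤

variable {G}

/-- Irreducible modules with the same highest weight are isomorphic. -/
theorem IsHighest.exists_equiv {V' : Type*} [AddCommGroup V'] [Module ℂ V'] {G' : GL3Ops V'}
    (hG : G.Irreducible) (hG' : G'.Irreducible) {v : V} {v' : V'} {a b : ℂ}
    (h : G.IsHighest v a b) (h' : G'.IsHighest v' a b) :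
    ∃ e : V ≃ₗ[ℂ] V', ∀ i j x, e (G.R i j x) = G'.R i j (e x) := by
  have hp : (G.prod G').IsHighest (v, v') a b :=
    { ne_zero := fun h0 => h.ne_zero (congrArg Prod.fst h0)
      raise₁ := by simp [h.raise₁, h'.raise₁]
      raise₂ := by simp [h.raise₂, h'.raise₂]
      weight₁ := by simp [h.weight₁, h'.weight₁]
      weight₂ := by simp [h.weight₂, h'.weight₂] }
  -- The submodule generated by `(v, v')` will be the graph of the isomorphism.
  set U := (G.prod G').wordSpan (v, v') with hU
  have hUinv := hp.wordSpan_invariant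
  have hvU : (v, v') ∈ U := (G.prod G').word_mem (v, v') []
  have fst_surj : U.map (LinearMap.fst ℂ V V') = ⊤ := by
    refine (hG _ ?_).resolve_left fun h0 => h.ne_zero ?_
    · rintro i j _ ⟨x, hx, rfl⟩
      exact ⟨_, hUinv i j x hx, rfl⟩
    · rw [← Submodule.mem_bot ℂ, ← h0]
      exact ⟨_, hvU, rfl⟩
  have snd_surj : U.map (LinearMap.snd ℂ V V') = ⊤ := by
    refine (hG' _ ?_).resolve_left fun h0 => h'.ne_zero ?_
    · rintro i j _ ⟨x, hx, rfl⟩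
      exact ⟨_, hUinv i j x hx, rfl⟩
    · rw [← Submodule.mem_bot ℂ, ← h0]
      exact ⟨_, hvU, rfl⟩
  -- Otherwise `U` contains `0 × V'`, hence `(0, v')`, which has the top weight; but the top weight
  -- space of `U` is the line through `(v, v')`, and `v ≠ 0`.
  have ker_fst : U.comap (LinearMap.inr ℂ V V') = ⊥ := by
    refine (hG' _ ?_).resolve_right fun h1 => h'.ne_zero ?_
    · intro i j y hy
      simpa using hUinv i j (0, y) hy
    · have hm : ((0 : V), v') ∈ U := by
        have : v' ∈ U.comap (LinearMap.inr ℂ V V') := h1 ▸ Submodule.mem_top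
        simpa using this
      obtain ⟨c, hc⟩ := Submodule.mem_span_singleton.1 (hp.mem_span_of_top hm (by
        rw [add_smul]
        simp [← h'.weight₁, ← h'.weight₂]))
      have hc0 : c = 0 := by
        simpa [h.ne_zero] using congrArg Prod.fst hc
      simpa [hc0, eq_comm] using congrArg Prod.snd hc
  have ker_snd : U.comap (LinearMap.inl ℂ V V') = ⊥ := by
    refine (hG _ ?_).resolve_right fun h1 => h.ne_zero ?_
    · intro i j y hy
      simpa using hUinv i j (y, 0) hy
    · have hm : (v, (0 : V')) ∈ U := by
        have : v ∈ U.comap (LinearMap.inl ℂ V V') := h1 ▸ Submodule.mem_top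
        simpa using this
      obtain ⟨c, hc⟩ := Submodule.mem_span_singleton.1 (hp.mem_span_of_top hm (by
        rw [add_smul]
        simp [← h.weight₁, ← h.weight₂]))
      have hc0 : c = 0 := by
        simpa [h'.ne_zero] using congrArg Prod.snd hc
      simpa [hc0, eq_comm] using congrArg Prod.fst hc
  have bij1 : Function.Bijective ((LinearMap.fst ℂ V V').domRestrict U) := by
    constructor
    · rw [← LinearMap.ker_eq_bot, LinearMap.ker_eq_bot']
      rintro ⟨⟨x, y⟩, hxy⟩ h0
      obtain rfl : x = 0 := h0
      have : y ∈ U.comap (LinearMap.inr ℂ V V') := hxy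
      rw [ker_fst, Submodule.mem_bot] at this
      simp [this]
    · intro x
      have : x ∈ U.map (LinearMap.fst ℂ V V') := fst_surj ▸ Submodule.mem_top
      obtain ⟨z, hz, hzx⟩ := this
      exact ⟨⟨z, hz⟩, hzx⟩
  have bij2 : Function.Bijective ((LinearMap.snd ℂ V V').domRestrict U) := by
    constructor
    · rw [← LinearMap.ker_eq_bot, LinearMap.ker_eq_bot']
      rintro ⟨⟨x, y⟩, hxy⟩ h0
      obtain rfl : y = 0 := h0
      have : x ∈ U.comap (LinearMap.inl ℂ V V') := hxy
      rw [ker_snd, Submodule.mem_bot] at this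
      simp [this]
    · intro x
      have : x ∈ U.map (LinearMap.snd ℂ V V') := snd_surj ▸ Submodule.mem_top
      obtain ⟨z, hz, hzx⟩ := this
      exact ⟨⟨z, hz⟩, hzx⟩
  let e1 := LinearEquiv.ofBijective _ bij1
  let e2 := LinearEquiv.ofBijective _ bij2
  refine ⟨e1.symm.trans e2, fun i j x => ?_⟩
  obtain ⟨z, rfl⟩ := e1.surjective x
  have hz : G.R i j (e1 z) = e1 ⟨_, hUinv i j z z.2⟩ := rfl
  rw [hz, LinearEquiv.trans_apply, LinearEquiv.trans_apply, e1.symm_apply_apply,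
    e1.symm_apply_apply]
  rfl

end GL3Ops

/-! ### The irreducible module with labels `(p, q)` -/

namespace GTSpace

/-- The indices of the Gelfand--Tsetlin basis of the module of highest weight `(p, q)`. -/
def Valid (p q : ℕ) : Set (ℕ × ℕ × ℕ) := {x | x.1 ≤ p ∧ x.2.1 ≤ q ∧ x.2.2 ≤ x.1 + x.2.1}

/-- The underlying space of the module of highest weight `(p, q)`. -/
def S (p q : ℕ) : Submodule ℂ GTSpace := Submodule.span ℂ (basis '' Valid p q)

theorem e_mem {p q k l m : ℕ} (hk : k ≤ p) (hl : l ≤ q) (hm : m ≤ k + l) : e k l m ∈ S p q :=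
  Submodule.subset_span ⟨(k, l, m), ⟨hk, hl, hm⟩, rfl⟩

theorem smul_e_mem {p q k l m : ℕ} {c : ℂ} (h : c ≠ 0 → k ≤ p ∧ l ≤ q ∧ m ≤ k + l) :
    c • e k l m ∈ S p q := by
  by_cases hc : c = 0
  · simp [hc]
  · obtain ⟨h1, h2, h3⟩ := h hc
    exact (S p q).smul_mem c (e_mem h1 h2 h3)

theorem S_le {p q : ℕ} {W : Submodule ℂ GTSpace}
    (h : ∀ k l m, k ≤ p → l ≤ q → m ≤ k + l → e k l m ∈ W) : S p q ≤ W := by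
  rw [S, Submodule.span_le]
  rintro _ ⟨⟨k, l, m⟩, ⟨hk, hl, hm⟩, rfl⟩
  exact h k l m hk hl hm

theorem S_eqOn {p q : ℕ} {f g : Module.End ℂ GTSpace}
    (h : ∀ k l m, m ≤ k + l → f (e k l m) = g (e k l m)) (w : S p q) : f w = g w := by
  have : S p q ≤ LinearMap.eqLocus f g := S_le fun k l m _ _ hm => h k l m hm
  exact this w.2

theorem up_self (a b l : ℕ) : up a b a l = 0 := by simp [up]

theorem up_ne_zero {a k : ℕ} (h : k < a) (b l : ℕ) : up a b k l ≠ 0 := by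
  have h1 : (a : ℂ) - k ≠ 0 := sub_ne_zero.2 (Nat.cast_injective.ne h.ne')
  have h2 : (b + k + 2 : ℂ) ≠ 0 := by exact_mod_cast Nat.succ_ne_zero (b + k + 1)
  have h3 : (k + l + 1 : ℂ) ≠ 0 := by exact_mod_cast Nat.succ_ne_zero (k + l)
  have h4 : (k + l + 2 : ℂ) ≠ 0 := by exact_mod_cast Nat.succ_ne_zero (k + l + 1)
  exact div_ne_zero (mul_ne_zero h1 h2) (mul_ne_zero h3 h4)

theorem lt_of_up_ne_zero {a b k l : ℕ} (hk : k ≤ a) (h : up a b k l ≠ 0) : k < a := by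
  refine lt_of_le_of_ne hk fun h' => h ?_
  rw [h', up_self]

theorem ne_of_sub_ne_zero {k l m : ℕ} (h : (k + l - m : ℂ) ≠ 0) : k + l ≠ m := by
  rintro rfl
  simp at h

/-- Whenever an index would leave the pattern, the coefficient vanishes: `up` at `k = p` or `l = q`,
the factors `k`, `l`, `m` at zero (which also makes the truncated subtractions harmless), and `k + l
- m` at the top of a string. -/
theorem E_mem {p q : ℕ} (i j : Fin 3) (w : GTSpace) (hw : w ∈ S p q) : E p q i j w ∈ S p q := by
  have : S p q ≤ (S p q).comap (E p q i j) := by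
    refine S_le fun k l m hk hl hm => ?_
    rw [Submodule.mem_comap]
    fin_cases i <;> fin_cases j <;>
      simp only [E, Fin.zero_eta, Fin.mk_one, Fin.reduceFinMk, Matrix.cons_val, lift_e]
    · exact smul_e_mem fun _ => ⟨hk, hl, hm⟩
    · refine smul_e_mem fun h => ?_
      have := ne_of_sub_ne_zero h
      omega
    · refine add_mem (smul_e_mem fun h => ?_) (smul_e_mem fun h => ?_)
      · have := lt_of_up_ne_zero hk h
        omega
      · rw [mul_ne_zero_iff, Nat.cast_ne_zero] at h
        have := ne_of_sub_ne_zero h.2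
        omega
    · refine smul_e_mem fun h => ?_
      omega
    · exact smul_e_mem fun _ => ⟨hk, hl, hm⟩
    · refine sub_mem (smul_e_mem fun h => ?_) (smul_e_mem fun h => ?_)
      · have := lt_of_up_ne_zero hk h
        omega
      · rw [mul_ne_zero_iff, Nat.cast_ne_zero, Nat.cast_ne_zero] at h
        omega
    · refine add_mem (smul_e_mem fun h => ?_) (smul_e_mem fun h => ?_)
      · rw [mul_ne_zero_iff, Nat.cast_ne_zero, Nat.cast_ne_zero] at h
        omega
      · have := lt_of_up_ne_zero hl h
        omega
    · refine sub_mem (smul_e_mem fun h => ?_) (smul_e_mem fun h => ?_)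
      · rw [mul_ne_zero_iff, Nat.cast_ne_zero] at h
        have := ne_of_sub_ne_zero h.2
        omega
      · have := lt_of_up_ne_zero hl h
        omega
    · exact smul_e_mem fun _ => ⟨hk, hl, hm⟩
  exact this hw

/-- The action of the matrix units on `S p q`. -/
def R (p q : ℕ) (i j : Fin 3) : Module.End ℂ (S p q) := (E p q i j).restrict (E_mem i j)

@[simp] theorem coe_R_apply (p q : ℕ) (i j : Fin 3) (w : S p q) :
    (R p q i j w : GTSpace) = E p q i j w := rfl

/-- Commutators that follow from others by the Jacobi identity. -/
theorem jacobi_comm {A : Type*} [Ring A] {a b c g x y d0 d1 d2 : A} (h1 : b * c - c * b = d0 - d2)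
    (h2 : a * c - c * a = -x) (h3 : a * b - b * a = 0) (h4 : d0 * a - a * d0 = a)
    (h5 : a * d2 - d2 * a = 0) (h6 : b * y - y * b = -g) (h7 : y * c - c * y = 0)
    (h8 : d0 * y - y * d0 = -y) (h9 : y * d2 - d2 * y = 0) (h10 : a * g - g * a = b)
    (h11 : a * y - y * a = d0 - d1) :
    b * x - x * b = a ∧ g * c - c * g = y ∧ g * x - x * g = d1 - d2 := by
  have k2 : g * c - c * g = y := by
    linear_combination (norm := noncomm_ring) y * h1 - h1 * y + h6 * c - b * h7 + h7 * b - c * h6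
      - h8 - h9
  refine ⟨?_, k2, ?_⟩
  · linear_combination (norm := noncomm_ring) h1 * a - a * h1 + h3 * c + b * h2 - h2 * b - c * h3
      + h4 + h5
  · linear_combination (norm := noncomm_ring) k2 * a - a * k2 + h10 * c + g * h2 - h2 * g
      - c * h10 + h1 - h11

theorem R_comm_lt (p q : ℕ) (i j r s : Fin 3) (hlt : 3 * (i : ℕ) + j < 3 * r + s) :
    R p q i j * R p q r s - R p q r s * R p q i j =
    (if j = r then R p q i s else 0) - (if s = i then R p q r j else 0) := by
  have base (i j r s : Fin 3) (hlt : 3 * (i : ℕ) + j < 3 * r + s)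
      (hne : (i, j, r, s) ≠ (0, 2, 2, 1) ∧ (i, j, r, s) ≠ (1, 2, 2, 0) ∧ (i, j, r, s) ≠ (1, 2, 2, 1)) :
      R p q i j * R p q r s - R p q r s * R p q i j =
      (if j = r then R p q i s else 0) - (if s = i then R p q r j else 0) := by
    refine LinearMap.ext fun w => Subtype.ext ?_
    refine (S_eqOn (E_comm_lt p q i j r s hlt hne) w).trans ?_
    split_ifs <;> simp
  have h1 := base 0 2 2 0 (by decide) (by decide)
  have h2 := base 0 1 2 0 (by decide) (by decide)
  have h3 := base 0 1 0 2 (by decide) (by decide)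
  have h4 := base 0 0 0 1 (by decide) (by decide)
  have h5 := base 0 1 2 2 (by decide) (by decide)
  have h6 := base 0 2 1 0 (by decide) (by decide)
  have h7 := base 1 0 2 0 (by decide) (by decide)
  have h8 := base 0 0 1 0 (by decide) (by decide)
  have h9 := base 1 0 2 2 (by decide) (by decide)
  have h10 := base 0 1 1 2 (by decide) (by decide)
  have h11 := base 0 1 1 0 (by decide) (by decide)
  simp at h1 h2 h3 h4 h5 h6 h7 h8 h9 h10 h11
  -- Here `a, b, c, g, x, y` are `E01, E02, E20, E12, E21, E10`.
  obtain ⟨k1, k2, k3⟩ := jacobi_comm h1 h2 h3 h4 h5 h6 h7 h8 h9 h10 h11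
  by_cases hne : (i, j, r, s) ≠ (0, 2, 2, 1) ∧
      (i, j, r, s) ≠ (1, 2, 2, 0) ∧ (i, j, r, s) ≠ (1, 2, 2, 1)
  · exact base i j r s hlt hne
  · have : (i, j, r, s) = (0, 2, 2, 1) ∨ (i, j, r, s) = (1, 2, 2, 0) ∨
      (i, j, r, s) = (1, 2, 2, 1) := by tauto
    simp only [Prod.mk.injEq] at this
    rcases this with ⟨rfl, rfl, rfl, rfl⟩ | ⟨rfl, rfl, rfl, rfl⟩ | ⟨rfl, rfl, rfl, rfl⟩
    · simpa using k1
    · simpa using k2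
    · simpa using k3

/-- The module of highest weight `(p, q)`. -/
def model (p q : ℕ) : GL3Ops (S p q) where
  R := R p q
  comm i j r s := by
    rcases lt_trichotomy (3 * (i : ℕ) + j) (3 * r + s) with h | h | h
    · exact R_comm_lt p q i j r s h
    · obtain ⟨rfl, rfl⟩ : i = r ∧ j = s := by omega
      simp only [sub_self, eq_comm]
    · have := R_comm_lt p q r s i j h
      rw [← neg_sub, this, neg_sub]
  sum_diag := by
    refine LinearMap.ext fun w => Subtype.ext ?_
    have := S_eqOn (f := ∑ i, E p q i i) (g := 0) (fun k l m _ => by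
      simp [Fin.sum_univ_three, E]; module) w
    simpa [Fin.sum_univ_three] using this

theorem model_R (p q : ℕ) (i j : Fin 3) : (model p q).R i j = R p q i j := rfl

/-- The highest weight vector. -/
def top (p q : ℕ) : S p q := ⟨e p 0 p, e_mem le_rfl (Nat.zero_le q) le_rfl⟩

theorem isHighest_top (p q : ℕ) : (model p q).IsHighest (top p q) p q where
  ne_zero h := basis.ne_zero (p, 0, p) (congrArg Subtype.val h)
  raise₁ := by ext1; simp [model_R, top, E]
  raise₂ := by ext1; simp [model_R, top, E, up_self]
  weight₁ := by ext1; simp [model_R, top, E]; module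
  weight₂ := by ext1; simp [model_R, top, E]; module

theorem coord_eq {f g : GTSpace →ₗ[ℂ] ℂ} (h : ∀ k l m, f (e k l m) = g (e k l m))
    (w : GTSpace) : f w = g w :=
  congrArg (fun f => f w) (basis.ext fun x => h x.1 x.2.1 x.2.2)

theorem ext_coord {w w' : GTSpace} (h : ∀ k l m, coord k l m w = coord k l m w') : w = w' :=
  basis.ext_elem fun x => h x.1 x.2.1 x.2.2

theorem coord_eq_zero {p q : ℕ} (w : S p q) {k l m : ℕ} (h : ¬ (k ≤ p ∧ l ≤ q ∧ m ≤ k + l)) :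
    coord k l m w = 0 := by
  have hw := basis.mem_span_image.1 w.2
  by_contra hne
  exact h (hw (Finsupp.mem_support_iff.2 hne))

theorem coord_E01 (p q : ℕ) (w : GTSpace) (k l m : ℕ) :
    coord k l (m + 1) (E p q 0 1 w) = (k + l - m) * coord k l m w := by
  refine coord_eq (f := coord k l (m + 1) ∘ₗ E p q 0 1) (g := (k + l - m : ℂ) • coord k l m)
    (fun k' l' m' => ?_) w
  simp [E, coord_e]
  grind

theorem coord_E02 (p q : ℕ) (w : GTSpace) (k l m : ℕ) :
    coord (k + 1) l (m + 1) (E p q 0 2 w) = up p q k l * coord k l m w +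
      ((l + 1) * (k + 1 + (l + 1) - (m + 1))) * coord (k + 1) (l + 1) (m + 1) w := by
  refine coord_eq (f := coord (k + 1) l (m + 1) ∘ₗ E p q 0 2) (g := up p q k l • coord k l m +
    ((l + 1 : ℂ) * (k + 1 + (l + 1) - (m + 1))) • coord (k + 1) (l + 1) (m + 1))
    (fun k' l' m' => ?_) w
  rcases l' with _ | l' <;> simp [E, coord_e] <;> (split_ifs <;> simp_all)

theorem coord_E12_zero (p q : ℕ) (w : GTSpace) (l m : ℕ) :
    coord 0 l m (E p q 1 2 w) = - ((l + 1) * (m + 1)) * coord 0 (l + 1) (m + 1) w := by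
  refine coord_eq (f := coord 0 l m ∘ₗ E p q 1 2)
    (g := (- ((l + 1) * (m + 1)) : ℂ) • coord 0 (l + 1) (m + 1)) (fun k' l' m' => ?_) w
  rcases l' with _ | l' <;> rcases m' with _ | m' <;> simp [E, coord_e] <;> split_ifs <;>
    simp_all

theorem coord_E12_succ (p q : ℕ) (w : GTSpace) (k l m : ℕ) :
    coord (k + 1) l m (E p q 1 2 w) = up p q k l * coord k l m w
      - ((l + 1) * (m + 1)) * coord (k + 1) (l + 1) (m + 1) w := by
  refine coord_eq (f := coord (k + 1) l m ∘ₗ E p q 1 2) (g := up p q k l • coord k l m -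
    ((l + 1) * (m + 1) : ℂ) • coord (k + 1) (l + 1) (m + 1)) (fun k' l' m' => ?_) w
  rcases l' with _ | l' <;> rcases m' with _ | m' <;> simp [E, coord_e] <;> split_ifs <;>
    simp_all

/-- Vanishing of `E01 w` leaves only the coordinates with `m = k + l`; then `E02 w = 0` removes
those with `k < p`, and `E12 w = 0` those with `k = p`, `l > 0`. Only the coordinate of `e p 0 p`
survives. -/
theorem mem_span_top {p q : ℕ} (w : S p q) (h1 : (model p q).R 0 1 w = 0)
    (h2 : (model p q).R 1 2 w = 0) : w ∈ Submodule.span ℂ {top p q} := by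
  have h3 : (model p q).R 0 2 w = 0 := by
    simpa [h1, h2] using ((model p q).comm_apply 0 1 1 2 w).symm
  replace h1 : E p q 0 1 w = 0 := congrArg Subtype.val h1
  replace h2 : E p q 1 2 w = 0 := congrArg Subtype.val h2
  replace h3 : E p q 0 2 w = 0 := congrArg Subtype.val h3
  have c1 (k l m : ℕ) (hm : m ≠ k + l) : coord k l m w = 0 := by
    have := coord_E01 p q w k l m
    rw [h1, map_zero, eq_comm, mul_eq_zero] at this
    refine this.resolve_left fun h => hm ?_
    exact_mod_cast (sub_eq_zero.1 h).symm
  have c2 (k l : ℕ) (hk : k < p) : coord k l (k + l) w = 0 := by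
    have := coord_E02 p q w k l (k + l)
    rw [h3, map_zero, c1 (k + 1) (l + 1) (k + l + 1) (by omega), mul_zero, add_zero, eq_comm,
      mul_eq_zero] at this
    exact this.resolve_left (up_ne_zero hk q l)
  have c3 (l : ℕ) : coord p (l + 1) (p + l + 1) w = 0 := by
    have hne : ((l : ℂ) + 1) * ((p + l : ℕ) + 1) ≠ 0 :=
      mul_ne_zero (Nat.cast_add_one_ne_zero _) (Nat.cast_add_one_ne_zero _)
    rcases p with _ | p
    · have := coord_E12_zero 0 q w l (0 + l)
      rw [h2, map_zero, eq_comm, mul_eq_zero] at this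
      exact this.resolve_left (neg_ne_zero.2 hne)
    · have := coord_E12_succ (p + 1) q w p l (p + 1 + l)
      rw [h2, map_zero, c1 p l _ (by omega), mul_zero, zero_sub, eq_comm, neg_eq_zero,
        mul_eq_zero] at this
      exact this.resolve_left hne
  refine Submodule.mem_span_singleton.2 ⟨coord p 0 p w, Subtype.ext (ext_coord fun k l m => ?_)⟩
  simp only [Submodule.coe_smul, top, map_smul, coord_e, smul_eq_mul, mul_ite, mul_one, mul_zero]
  split_ifs with h
  · obtain ⟨rfl, rfl, rfl⟩ := h; rfl
  · by_cases hm : m = k + l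
    · subst hm
      rcases lt_trichotomy k p with hk | rfl | hk
      · exact (c2 k l hk).symm
      · rcases l with _ | l
        · simp at h
        · exact (c3 l).symm
      · exact (coord_eq_zero w (by omega)).symm
    · exact (c1 k l m hm).symm

/-- `E10` descends each string in `m`. On tops of strings, `E21` raises `l` when `k = p`, and `E20`
lowers `k` modulo vectors already obtained for `k + 1`. -/
theorem mem_of_top_mem {p q : ℕ} {W : Submodule ℂ GTSpace}
    (hW : ∀ i j, ∀ w ∈ W, E p q i j w ∈ W) (h0 : e p 0 p ∈ W) : S p q ≤ W := by
  have cancel {c : ℂ} {w : GTSpace} (hc : c ≠ 0) (h : c • w ∈ W) : w ∈ W :=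
    (W.smul_mem_iff hc).1 h
  have low (k l d m : ℕ) (hm : m + d = k + l) (h : e k l (k + l) ∈ W) : e k l m ∈ W := by
    induction d generalizing m with
    | zero => rwa [show m = k + l from hm]
    | succ d ih =>
      have h1 := hW 1 0 _ (ih (m + 1) (by omega))
      simp only [E, Matrix.cons_val, lift_e, Nat.add_sub_cancel] at h1
      exact cancel (Nat.cast_ne_zero.2 m.succ_ne_zero) h1
  have first (l : ℕ) (hl : l ≤ q) : e p l (p + l) ∈ W := by
    induction l with
    | zero => exact h0
    | succ l ih =>
      have h1 := hW 2 1 _ (ih (by omega))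
      simp only [E, Matrix.cons_val, lift_e, Nat.cast_add, sub_self, mul_zero, zero_smul,
        zero_sub] at h1
      exact cancel (up_ne_zero hl p p) (W.neg_mem_iff.1 h1)
  have tops (d k : ℕ) (hk : k + d = p) : ∀ l ≤ q, e k l (k + l) ∈ W := by
    induction d generalizing k with
    | zero => rw [show k = p from hk]; exact first
    | succ d ih =>
      intro l hl
      have ih' := ih (k + 1) (by omega)
      have h1 := hW 2 0 _ (ih' l hl)
      simp only [E, Matrix.cons_val, lift_e, Nat.add_sub_cancel] at h1
      -- The unwanted term lies one step below the top of the string `(k + 1, l + 1)`; for `l = q`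
      -- its coefficient is zero.
      have h2 : up q p l (k + 1) • e (k + 1) (l + 1) (k + 1 + l) ∈ W := by
        rcases hl.lt_or_eq with h | rfl
        · exact W.smul_mem _ (low _ _ 1 _ (by omega) (ih' (l + 1) h))
        · simp [up_self]
      rw [W.add_mem_iff_left h2, show k + 1 + l - 1 = k + l by omega] at h1
      refine cancel ?_ h1
      exact_mod_cast (by positivity : (k + 1) * (k + 1 + l) ≠ 0)
  refine S_le fun k l m hk hl hm => ?_
  obtain ⟨d, rfl⟩ := Nat.exists_eq_add_of_le hk
  exact low k l (k + l - m) m (by omega) (tops d k rfl l hl)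

theorem valid_finite (p q : ℕ) : (Valid p q).Finite := by
  refine ((Set.finite_Iic p).prod ((Set.finite_Iic q).prod (Set.finite_Iic (p + q)))).subset ?_
  rintro ⟨k, l, m⟩ ⟨hk, hl, hm⟩
  simp only [Set.mem_prod, Set.mem_Iic] at *
  omega

instance (p q : ℕ) : FiniteDimensional ℂ (S p q) :=
  FiniteDimensional.span_of_finite ℂ ((valid_finite p q).image _)

/-- A nonzero invariant subspace has a highest weight vector of its own, which must be a multiple of
`top p q`, and that vector generates everything. -/
theorem model_irreducible (p q : ℕ) : (model p q).Irreducible := by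
  intro W hW
  rcases eq_or_ne W ⊥ with h | h
  · exact Or.inl h
  · right
    have : Nontrivial W := Submodule.nontrivial_iff_ne_bot.2 h
    obtain ⟨⟨w, hwW⟩, a, b, hw⟩ := ((model p q).restrict W hW).exists_isHighest
    have hmem := mem_span_top w (congrArg Subtype.val hw.raise₁) (congrArg Subtype.val hw.raise₂)
    obtain ⟨c, rfl⟩ := Submodule.mem_span_singleton.1 hmem
    have hc : c ≠ 0 := by
      rintro rfl
      exact hw.ne_zero (Subtype.ext (zero_smul ℂ _))
    have htop : top p q ∈ W := (W.smul_mem_iff hc).1 hwW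
    have := mem_of_top_mem (p := p) (q := q) (W := W.map (S p q).subtype) (by
      rintro i j _ ⟨x, hx, rfl⟩
      exact ⟨_, hW i j x hx, rfl⟩) ⟨_, htop, rfl⟩
    rw [eq_top_iff]
    rintro x -
    obtain ⟨y, hy, hyx⟩ := this x.2
    rwa [← Subtype.ext hyx]

theorem eq_of_isHighest {p q : ℕ} {v : S p q} {a b : ℂ} (h : (model p q).IsHighest v a b) :
    a = p ∧ b = q := by
  obtain ⟨c, rfl⟩ := Submodule.mem_span_singleton.1 (mem_span_top v h.raise₁ h.raise₂)
  have h1 := h.weight₁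
  have h2 := h.weight₂
  rw [map_smul, map_smul, ← smul_sub, (isHighest_top p q).weight₁, smul_comm] at h1
  rw [map_smul, map_smul, ← smul_sub, (isHighest_top p q).weight₂, smul_comm] at h2
  exact ⟨(smul_left_injective ℂ h.ne_zero h1).symm, (smul_left_injective ℂ h.ne_zero h2).symm⟩

theorem finrank_S (p q : ℕ) :
    2 * Module.finrank ℂ (S p q) = (p + 1) * (q + 1) * (p + q + 2) := by
  let T : Finset (Σ _ : ℕ, Σ _ : ℕ, ℕ) := (Finset.range (p + 1)).sigma fun k =>
    (Finset.range (q + 1)).sigma fun l => Finset.range (k + l + 1)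
  have hT : Set.BijOn (fun x : Σ _ : ℕ, Σ _ : ℕ, ℕ => (x.1, x.2.1, x.2.2)) T (Valid p q) := by
    refine ⟨?_, ?_, ?_⟩
    · rintro ⟨k, l, m⟩ h
      simp [T, Valid] at h ⊢
      omega
    · rintro ⟨k, l, m⟩ - ⟨k', l', m'⟩ - h
      simp only [Prod.mk.injEq] at h
      obtain ⟨rfl, rfl, rfl⟩ := h
      rfl
    · rintro ⟨k, l, m⟩ h
      refine ⟨⟨k, l, m⟩, ?_, rfl⟩
      simp [T, Valid] at h ⊢
      omega
  have hcard : Module.finrank ℂ (S p q) = T.card := by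
    have := (valid_finite p q).fintype
    have hli : LinearIndependent ℂ (fun x : Valid p q => basis (x : ℕ × ℕ × ℕ)) :=
      basis.linearIndependent.comp _ Subtype.val_injective
    rw [S, Set.image_eq_range, finrank_span_eq_card hli, ← Nat.card_eq_fintype_card,
      Nat.card_coe_set_eq, ← hT.image_eq, hT.injOn.ncard_image, Set.ncard_coe_finset]
  have h1 (k n : ℕ) : 2 * ∑ l ∈ Finset.range n, (k + l + 1) = n * (2 * k + n + 1) := by
    induction n with
    | zero => simp
    | succ n ih => rw [Finset.sum_range_succ, mul_add, ih]; ring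
  have h2 (n : ℕ) : ∑ k ∈ Finset.range n, (q + 1) * (2 * k + (q + 1) + 1) =
      n * (q + 1) * (n + q + 1) := by
    induction n with
    | zero => simp
    | succ n ih => rw [Finset.sum_range_succ, ih]; ring
  rw [hcard]
  simp only [T, Finset.card_sigma, Finset.card_range, Finset.mul_sum]
  simp only [← Finset.mul_sum, h1]
  rw [Finset.mul_sum, h2]
  ring

end GTSpace

/-! ### Classification of the irreducible representations of `su(3)` -/

namespace GL3Ops

variable {V V' : Type*} [AddCommGroup V] [Module ℂ V] [AddCommGroup V'] [Module ℂ V']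

/-- Transport along a linear equivalence. -/
def transport (G : GL3Ops V) (e : V ≃ₗ[ℂ] V') : GL3Ops V' where
  R i j := e.conj (G.R i j)
  comm i j r s := by
    ext w
    simp only [LinearMap.sub_apply, Module.End.mul_apply, LinearEquiv.conj_apply_apply,
      LinearEquiv.symm_apply_apply, G.comm_apply i j r s, map_add, add_sub_cancel_left, map_sub]
    split_ifs <;> simp
  sum_diag := by
    rw [← map_sum, G.sum_diag, map_zero]

theorem transport_R (G : GL3Ops V) (e : V ≃ₗ[ℂ] V') (i j : Fin 3) (x : V) :
    (G.transport e).R i j (e x) = e (G.R i j x) := by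
  simp [transport, LinearEquiv.conj_apply_apply]

variable {G : GL3Ops V} {G' : GL3Ops V'} {e : V ≃ₗ[ℂ] V'}

theorem Irreducible.of_equiv (h : G.Irreducible)
    (he : ∀ i j x, e (G.R i j x) = G'.R i j (e x)) : G'.Irreducible := by
  intro W hW
  have := h (W.comap e.toLinearMap) fun i j w hw => by
    simpa [he] using hW i j (e w) hw
  refine this.imp (fun h => ?_) fun h => ?_
  · rw [eq_bot_iff]
    intro w hw
    have : e.symm w ∈ W.comap e.toLinearMap := by simpa using hw
    simpa [h] using this
  · rw [eq_top_iff]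
    intro w _
    have : e.symm w ∈ W.comap e.toLinearMap := h ▸ Submodule.mem_top
    simpa using this

theorem IsHighest.of_equiv {v : V} {a b : ℂ} (h : G.IsHighest v a b)
    (he : ∀ i j x, e (G.R i j x) = G'.R i j (e x)) : G'.IsHighest (e v) a b where
  ne_zero := by simpa using h.ne_zero
  raise₁ := by rw [← he, h.raise₁, map_zero]
  raise₂ := by rw [← he, h.raise₂, map_zero]
  weight₁ := by rw [← he, ← he, ← map_sub, h.weight₁, map_smul]
  weight₂ := by rw [← he, ← he, ← map_sub, h.weight₂, map_smul]

end GL3Ops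

/-- The irreducible representation of `su 3` of highest weight `(p, q)`. -/
def su3Irrep (p q : ℕ) : LieIrrep (su 3) where
  dim := Module.finrank ℂ (GTSpace.S p q)
  ρ := ((GTSpace.model p q).transport (Module.finBasis ℂ (GTSpace.S p q)).equivFun).lieHom
  dim_pos := by
    have := GTSpace.finrank_S p q
    refine Nat.pos_of_ne_zero fun h => ?_
    rw [h, mul_zero] at this
    exact absurd this.symm (by positivity)
  irreducible W hW := by
    rw [GL3Ops.invariant_iff] at hW
    exact (GTSpace.model_irreducible p q).of_equiv
      (fun i j x => (GL3Ops.transport_R _ _ i j x).symm) W hW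

theorem su3Irrep_injective {p q p' q' : ℕ} (h : (su3Irrep p q).Equivalent (su3Irrep p' q')) :
    p = p' ∧ q = q' := by
  obtain ⟨f, hf⟩ := h
  have hf' := (GL3Ops.intertwines_iff _ _ f.toLinearMap).1 hf
  set e := (Module.finBasis ℂ (GTSpace.S p q)).equivFun
  set e' := (Module.finBasis ℂ (GTSpace.S p' q')).equivFun
  have h1 := (GTSpace.isHighest_top p q).of_equiv
    (fun i j x => (GL3Ops.transport_R _ e i j x).symm)
  have h2 := h1.of_equiv (e := f) hf'
  have h3 := h2.of_equiv (G' := GTSpace.model p' q') (e := e'.symm) fun i j x => by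
    obtain ⟨y, rfl⟩ := e'.surjective x
    rw [GL3Ops.transport_R, e'.symm_apply_apply, e'.symm_apply_apply]
  obtain ⟨h4, h5⟩ := GTSpace.eq_of_isHighest h3
  exact ⟨Nat.cast_injective h4, Nat.cast_injective h5⟩

theorem exists_equivalent_su3Irrep (V : LieIrrep (su 3)) :
    ∃ p q, (su3Irrep p q).Equivalent V := by
  set G := GL3Ops.ofLieHom V.ρ with hG
  have hρ : G.lieHom = V.ρ := GL3Ops.lieHom_ofLieHom V.ρ
  have hirr : G.Irreducible := fun W hW => V.irreducible W (by
    rw [← hρ]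
    exact (G.invariant_iff W).2 hW)
  have : Nonempty (Fin V.dim) := ⟨⟨0, V.dim_pos⟩⟩
  obtain ⟨v, a, b, hv⟩ := G.exists_isHighest
  obtain ⟨p, q, rfl, rfl⟩ := hv.exists_nat
  refine ⟨p, q, ?_⟩
  have h1 := (GTSpace.isHighest_top p q).of_equiv (fun i j x =>
    (GL3Ops.transport_R _ (Module.finBasis ℂ (GTSpace.S p q)).equivFun i j x).symm)
  have h2 := (GTSpace.model_irreducible p q).of_equiv (fun i j x =>
    (GL3Ops.transport_R _ (Module.finBasis ℂ (GTSpace.S p q)).equivFun i j x).symm)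
  obtain ⟨f, hf⟩ := h1.exists_equiv h2 hirr hv
  refine ⟨f, ?_⟩
  have := (GL3Ops.intertwines_iff _ _ f.toLinearMap).2 hf
  rw [hρ] at this
  exact this

/-- The irreducible representations of `su 3` are classified by their highest weights. -/
def su3Class (x : ℕ × ℕ) : IrrepClass (su 3) :=
  Quotient.mk (LieIrrep.setoid (su 3)) (su3Irrep x.1 x.2)

theorem su3Class_bijective : Function.Bijective su3Class := by
  constructor
  · rintro ⟨p, q⟩ ⟨p', q'⟩ h
    obtain ⟨rfl, rfl⟩ := su3Irrep_injective (Quotient.exact h)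
    rfl
  · intro c
    induction c using Quotient.inductionOn with
    | h V =>
      obtain ⟨p, q, h⟩ := exists_equivalent_su3Irrep V
      exact ⟨(p, q), Quotient.sound h⟩

theorem two_mul_dim_su3Class (x : ℕ × ℕ) :
    2 * (su3Class x).dim = (x.1 + 1) * (x.2 + 1) * (x.1 + x.2 + 2) :=
  GTSpace.finrank_S x.1 x.2

/-! ### Counting labels -/

/-- The pairs of Dynkin labels of the representations of dimension less than `D`. -/
def labelsBelow (D : ℝ) : Set (ℕ × ℕ) :=
  {x | ((x.1 + 1) * (x.2 + 1) * (x.1 + x.2 + 2) : ℝ) < 2 * D}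

theorem su3IrrepsBelow_eq (D : ℝ) : su3IrrepsBelow D = su3Class '' labelsBelow D := by
  have key (x : ℕ × ℕ) : su3Class x ∈ su3IrrepsBelow D ↔ x ∈ labelsBelow D := by
    have h : (2 * (su3Class x).dim : ℝ) = (x.1 + 1) * (x.2 + 1) * (x.1 + x.2 + 2) := by
      exact_mod_cast two_mul_dim_su3Class x
    rw [su3IrrepsBelow, labelsBelow, Set.mem_ofPred_eq, Set.mem_ofPred_eq, ← h]
    constructor <;> intro h <;> linarith
  ext c
  constructor
  · intro hc
    obtain ⟨x, rfl⟩ := su3Class_bijective.2 c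
    exact ⟨x, (key x).1 hc, rfl⟩
  · rintro ⟨x, hx, rfl⟩
    exact (key x).2 hx

/-- The integers `y` with `0 ≤ y ≤ x - 2` for which the labels `(y, x - 2 - y)` belong to a
representation of dimension at least `D`. -/
def excluded (D : ℝ) (x : ℤ) : Finset ℤ :=
  {y ∈ Finset.Icc 0 (x - 2) | 2 * D ≤ ((y + 1) * (x - 1 - y) * x : ℝ)}

/-- The complement of `excluded`. -/
def kept (D : ℝ) (x : ℤ) : Finset ℤ :=
  {y ∈ Finset.Icc 0 (x - 2) | ¬ 2 * D ≤ ((y + 1) * (x - 1 - y) * x : ℝ)}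

theorem card_kept (D : ℝ) {x : ℤ} (hx : 1 ≤ x) :
    ((kept D x).card : ℝ) = (x - 1) - (excluded D x).card := by
  have h : (excluded D x).card + (kept D x).card = (x - 2 + 1 - 0).toNat :=
    (Finset.card_filter_add_card_filter_not _).trans (Int.card_Icc _ _)
  have h' : (((x - 2 + 1 - 0).toNat : ℤ) : ℝ) = x - 1 := by
    rw [Int.toNat_of_nonneg (by omega)]
    push_cast
    ring
  rw [← h', eq_sub_iff_add_eq']
  exact_mod_cast h

/-- The hypothesis says `(2x - 1)² ≤ 1 + 8 D`. -/
theorem le_lIndex {D : ℝ} {x : ℤ} (h : (x * (x - 1) : ℝ) ≤ 2 * D) :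
    x ≤ lIndex D := by
  rw [lIndex, Int.le_floor]
  have : (2 * x - 1 : ℝ) ≤ √(1 + 8 * D) := Real.le_sqrt_of_sq_le (by linarith)
  linarith

theorem one_le_lIndex {D : ℝ} (hD : 0 < D) : 1 ≤ lIndex D :=
  le_lIndex (by simpa using hD.le)

theorem bijOn_labelsBelow (D : ℝ) :
    Set.BijOn (fun x : ℕ × ℕ => (⟨x.1 + x.2 + 2, x.1⟩ : Σ _ : ℤ, ℤ)) (labelsBelow D)
      ((Finset.Icc 1 (lIndex D)).sigma (kept D)) := by
  refine ⟨?_, ?_, ?_⟩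
  · rintro ⟨p, q⟩ h
    simp only [labelsBelow, Set.mem_ofPred_eq] at h
    simp only [SetLike.mem_coe, Finset.mem_sigma, Finset.mem_Icc, kept, Finset.mem_filter, not_le]
    refine ⟨⟨by omega, le_lIndex ?_⟩, ⟨by omega, by omega⟩, ?_⟩
    · push_cast
      have hp : (0 : ℝ) ≤ p := p.cast_nonneg
      have hq : (0 : ℝ) ≤ q := q.cast_nonneg
      -- With `x = p + q + 2`, `(p + 1)(q + 1) = pq + (x - 1) ≥ x - 1`.
      nlinarith [mul_nonneg (mul_nonneg hp hq) (by positivity : (0 : ℝ) ≤ p + q + 2)]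
    · push_cast
      linarith
  · rintro ⟨p, q⟩ - ⟨p', q'⟩ - h
    simp only [Sigma.mk.injEq, heq_eq_eq] at h
    ext <;> omega
  · rintro ⟨x, y⟩ h
    simp only [SetLike.mem_coe, Finset.mem_sigma, Finset.mem_Icc, kept, Finset.mem_filter,
      not_le] at h
    obtain ⟨hx, hy, h⟩ := h
    lift y to ℕ using hy.1
    obtain ⟨q, hq⟩ := Int.eq_ofNat_of_zero_le (by omega : 0 ≤ x - 2 - y)
    obtain rfl : x = y + q + 2 := by omega
    refine ⟨(y, q), ?_, rfl⟩
    simp only [labelsBelow, Set.mem_ofPred_eq]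
    push_cast at h
    linarith

theorem su3IrrepsBelow_finite (D : ℝ) : (su3IrrepsBelow D).Finite := by
  rw [su3IrrepsBelow_eq]
  exact ((bijOn_labelsBelow D).finite_iff_finite.2 (Finset.finite_toSet _)).image _

theorem irrepCount_eq {D : ℝ} (hD : 0 < D) : (irrepCount D : ℝ) =
    (1 / 2 : ℝ) * (lIndex D : ℝ) * ((lIndex D : ℝ) - 1) -
      ∑ x ∈ Finset.Icc 1 (lIndex D), ((excluded D x).card : ℝ) := by
  have hb := bijOn_labelsBelow D
  have hsum (n : ℕ) : ∑ x ∈ Finset.Icc (1 : ℤ) n, ((x : ℝ) - 1) = 1 / 2 * n * (n - 1) := by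
    induction n with
    | zero => simp
    | succ n ih =>
      have : Finset.Icc (1 : ℤ) (n + 1 : ℕ) = insert ((n + 1 : ℕ) : ℤ) (Finset.Icc (1 : ℤ) n) := by
        ext y
        simp only [Finset.mem_Icc, Finset.mem_insert]
        omega
      rw [this, Finset.sum_insert (by simp), ih]
      push_cast
      ring
  obtain ⟨n, hn⟩ := Int.eq_ofNat_of_zero_le (zero_le_one.trans (one_le_lIndex hD))
  rw [irrepCount, su3IrrepsBelow_eq, Set.ncard_image_of_injective _ su3Class_bijective.1,
    ← hb.injOn.ncard_image, hb.image_eq, Set.ncard_coe_finset, Finset.card_sigma, Nat.cast_sum,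
    Finset.sum_congr rfl fun x hx => card_kept D (Finset.mem_Icc.1 hx).1, Finset.sum_sub_distrib,
    hn, hsum]
  simp

theorem rpow_third_pow {D : ℝ} (hD : 0 < D) : (D ^ (1 / 3 : ℝ)) ^ 3 = D := by
  rw [← Real.rpow_natCast, ← Real.rpow_mul hD.le]
  norm_num

theorem kIndex_nonneg {D : ℝ} (hD : 0 < D) : 0 ≤ kIndex D :=
  Int.floor_nonneg.2 (by positivity)

theorem lt_of_kIndex_lt {D : ℝ} (hD : 0 < D) {x : ℤ} (hx : kIndex D < x) :
    8 * D < (x : ℝ) ^ 3 := by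
  have h := Int.floor_lt.1 hx
  have := pow_lt_pow_left₀ h (by positivity) (n := 3) (by norm_num)
  rw [mul_pow, rpow_third_pow hD] at this
  linarith

theorem le_of_le_kIndex {D : ℝ} (hD : 0 < D) {x : ℤ} (h1 : 1 ≤ x) (hx : x ≤ kIndex D) :
    (x : ℝ) ^ 3 ≤ 8 * D := by
  have h := Int.le_floor.1 hx
  have := pow_le_pow_left₀ (by exact_mod_cast (by omega : 0 ≤ x)) h 3
  rw [mul_pow, rpow_third_pow hD] at this
  linarith

/-- From `4 (y + 1)(x - 1 - y) = x² - (2y + 2 - x)²`, exclusion means `|2y + 2 - x| ≤ √(x² - 8 D /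
x)`, and the radicand is nonnegative since `x³ > 8 D`. -/
theorem card_excluded_of_kIndex_lt {D : ℝ} (hD : 0 < D) {x : ℤ} (hx : kIndex D < x) :
    ((excluded D x).card : ℝ) = (⌊yPlus D (x : ℝ)⌋ : ℝ) - (⌈yMinus D (x : ℝ)⌉ : ℝ) + 1 := by
  have hx0 : (0 : ℝ) < x := by exact_mod_cast (kIndex_nonneg hD).trans_lt hx
  have hx3 := lt_of_kIndex_lt hD hx
  have hΔ : 0 ≤ (x : ℝ) ^ 2 - 8 * D / x := by
    rw [sub_nonneg, div_le_iff₀ hx0]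
    nlinarith
  have heq : excluded D x = Finset.Icc ⌈yMinus D x⌉ ⌊yPlus D x⌋ := by
    ext y
    have hiff : y ∈ Finset.Icc ⌈yMinus D x⌉ ⌊yPlus D x⌋ ↔
        2 * D ≤ ((y + 1) * (x - 1 - y) * x : ℝ) := by
      rw [Finset.mem_Icc, Int.ceil_le, Int.le_floor, yMinus, yPlus]
      have habs : (((x : ℝ) - 2) / 2 - 1 / 2 * √((x : ℝ) ^ 2 - 8 * D / x) ≤ y ∧
          (y : ℝ) ≤ ((x : ℝ) - 2) / 2 + 1 / 2 * √((x : ℝ) ^ 2 - 8 * D / x)) ↔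
          |2 * (y : ℝ) + 2 - x| ≤ √((x : ℝ) ^ 2 - 8 * D / x) := by
        rw [abs_le]
        constructor <;> rintro ⟨h1, h2⟩ <;> constructor <;> linarith
      rw [habs, Real.le_sqrt (abs_nonneg _) hΔ, sq_abs, le_sub_comm, div_le_iff₀ hx0]
      constructor <;> intro h <;> nlinarith
    rw [hiff, excluded, Finset.mem_filter, and_iff_right_iff_imp]
    intro h
    -- The range `0 ≤ y ≤ x - 2` is automatic: the two factors have positive product and positive
    -- sum `x`.
    have hpos : (0 : ℝ) < (y + 1) * (x - 1 - y) := by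
      by_contra! hneg
      nlinarith
    have hpos' : 0 < (y + 1) * (x - 1 - y) := by exact_mod_cast hpos
    have hx0' : 0 < x := by exact_mod_cast hx0
    rw [Finset.mem_Icc]
    rcases pos_and_pos_or_neg_and_neg_of_mul_pos hpos' with h | h <;> omega
  -- Even if the interval contains no integer, the count is `0` rather than negative, so `toNat`
  -- loses nothing.
  have hle : ⌈yMinus D x⌉ ≤ ⌊yPlus D x⌋ + 1 := by
    rw [Int.ceil_le]
    have h1 : yMinus D x ≤ yPlus D x := by
      rw [yMinus, yPlus]
      have := Real.sqrt_nonneg ((x : ℝ) ^ 2 - 8 * D / x)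
      linarith
    push_cast
    exact h1.trans (Int.lt_floor_add_one _).le
  have hcard : ((excluded D x).card : ℤ) = ⌊yPlus D x⌋ + 1 - ⌈yMinus D x⌉ := by
    rw [heq, Int.card_Icc, Int.toNat_of_nonneg (by omega)]
  have := congrArg (Int.cast : ℤ → ℝ) hcard
  push_cast at this
  rw [this]
  ring

/-- Exclusion gives `8 D ≤ x³ - x (2y + 2 - x)²`, while `x³ ≤ 8 D`; so the square vanishes and
equality holds throughout. -/
theorem eq_of_mem_excluded {D : ℝ} (hD : 0 < D) {x y : ℤ} (h1 : 1 ≤ x) (hx : x ≤ kIndex D)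
    (hy : y ∈ excluded D x) : x = 2 * (y + 1) ∧ D = (y + 1 : ℝ) ^ 3 := by
  have hx0 : (0 : ℝ) < x := by exact_mod_cast h1
  have hx3 := le_of_le_kIndex hD h1 hx
  have h := (Finset.mem_filter.1 hy).2
  have hsq : (2 * (y + 1) - x : ℝ) ^ 2 = 0 := by
    by_contra hne
    have : 0 < (2 * (y + 1) - x : ℝ) ^ 2 := lt_of_le_of_ne (sq_nonneg _) (Ne.symm hne)
    nlinarith [mul_pos this hx0]
  have hxy : (x : ℝ) = 2 * (y + 1) := by
    have := pow_eq_zero_iff (two_ne_zero) |>.1 hsq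
    linarith
  refine ⟨by exact_mod_cast hxy, ?_⟩
  rw [hxy] at h hx3
  apply le_antisymm <;> nlinarith

/-- The labels `(m - 1, m - 1)` give dimension exactly `m³`. -/
theorem mem_excluded_of_cube {m : ℕ} (hm : 0 < m) :
    (m : ℤ) - 1 ∈ excluded ((m : ℝ) ^ 3) (2 * m) := by
  rw [excluded, Finset.mem_filter, Finset.mem_Icc]
  refine ⟨⟨by omega, by omega⟩, ?_⟩
  push_cast
  apply le_of_eq
  ring

theorem sum_excluded {D : ℝ} (hD : 0 < D) :
    ∑ x ∈ Finset.Icc 1 (lIndex D), ((excluded D x).card : ℝ) =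
      ∑ x ∈ Finset.Icc 1 (lIndex D) with x ≤ kIndex D, ((excluded D x).card : ℝ) +
      ∑ x ∈ Finset.Icc (kIndex D + 1) (lIndex D),
        ((⌊yPlus D (x : ℝ)⌋ : ℝ) - (⌈yMinus D (x : ℝ)⌉ : ℝ) + 1) := by
  have hk := kIndex_nonneg hD
  rw [← Finset.sum_filter_add_sum_filter_not _ (fun x => x ≤ kIndex D)]
  congr 1
  have : Finset.filter (fun x => ¬ x ≤ kIndex D) (Finset.Icc 1 (lIndex D)) =
      Finset.Icc (kIndex D + 1) (lIndex D) := by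
    ext x
    simp only [Finset.mem_filter, Finset.mem_Icc]
    omega
  rw [this]
  refine Finset.sum_congr rfl fun x hx => card_excluded_of_kIndex_lt hD ?_
  have := (Finset.mem_Icc.1 hx).1
  omega

theorem irrepCount_eq_countFormula_sub {D : ℝ} (hD : 0 < D) :
    (irrepCount D : ℝ) = countFormula D -
      ∑ x ∈ Finset.Icc 1 (lIndex D) with x ≤ kIndex D, ((excluded D x).card : ℝ) := by
  rw [irrepCount_eq hD, sum_excluded hD, countFormula]
  ring

end

theorem mainTheorem3 (D : ℝ) (hD : 0 < D) :
    (su3IrrepsBelow D).Finite ∧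
    ((∀ m : ℕ, D ≠ (m : ℝ) ^ 3) → (irrepCount D : ℝ) = countFormula D) ∧
    ((∃ m : ℕ, D = (m : ℝ) ^ 3) → (irrepCount D : ℝ) = countFormula D - 1) := by
  refine ⟨su3IrrepsBelow_finite D, fun hne => ?_, ?_⟩
  · rw [irrepCount_eq_countFormula_sub hD, sub_eq_self]
    refine Finset.sum_eq_zero fun x hx => ?_
    rw [Finset.mem_filter, Finset.mem_Icc] at hx
    rw [Nat.cast_eq_zero, Finset.card_eq_zero, Finset.eq_empty_iff_forall_notMem]
    intro y hy
    have hy0 := (Finset.mem_Icc.1 (Finset.mem_filter.1 hy).1).1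
    lift y to ℕ using hy0
    refine hne (y + 1) ?_
    have := (eq_of_mem_excluded hD hx.1.1 hx.2 hy).2
    exact_mod_cast this
  · rintro ⟨m, rfl⟩
    have hm : 0 < m := Nat.pos_of_ne_zero fun h => by simp [h] at hD
    have hm' : (1 : ℝ) ≤ m := by exact_mod_cast hm
    -- `2m³ - 2m(2m - 1) = 2m(m - 1)² ≥ 0`.
    have hl : (2 * m : ℤ) ≤ lIndex ((m : ℝ) ^ 3) := by
      refine le_lIndex ?_
      push_cast
      nlinarith [mul_nonneg (by positivity : (0 : ℝ) ≤ m) (sq_nonneg ((m : ℝ) - 1))]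
    have hk : (2 * m : ℤ) ≤ kIndex ((m : ℝ) ^ 3) := by
      by_contra! h
      have := lt_of_kIndex_lt hD h
      push_cast at this
      nlinarith
    have huniq {x y : ℤ} (h1 : 1 ≤ x) (hx : x ≤ kIndex ((m : ℝ) ^ 3))
        (hy : y ∈ excluded ((m : ℝ) ^ 3) x) : x = 2 * m ∧ y = m - 1 := by
      obtain ⟨h2, h3⟩ := eq_of_mem_excluded hD h1 hx hy
      have h4 : (0 : ℝ) ≤ y + 1 := by exact_mod_cast (by omega : 0 ≤ y + 1)
      have h5 : (m : ℝ) = y + 1 := (pow_left_inj₀ (by positivity) h4 (by norm_num)).1 h3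
      have h6 : (m : ℤ) = y + 1 := by exact_mod_cast h5
      omega
    rw [irrepCount_eq_countFormula_sub hD]
    congr 1
    rw [Finset.sum_eq_single (2 * m : ℤ)]
    · have : excluded ((m : ℝ) ^ 3) (2 * m) = {(m : ℤ) - 1} := by
        refine Finset.eq_singleton_iff_unique_mem.2 ⟨mem_excluded_of_cube hm, fun y hy => ?_⟩
        exact (huniq (by omega) hk hy).2
      rw [this, Finset.card_singleton, Nat.cast_one]
    · intro x hx hne
      rw [Finset.mem_filter, Finset.mem_Icc] at hx
      rw [Nat.cast_eq_zero, Finset.card_eq_zero, Finset.eq_empty_iff_forall_notMem]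
      exact fun y hy => hne (huniq hx.1.1 hx.2 hy).1
    · intro h
      exact absurd (Finset.mem_filter.2 ⟨Finset.mem_Icc.2 ⟨by omega, hl⟩, hk⟩) h
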